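/- Let $\alpha$ be a positive integer. Let $V_0=\mathbb C[h_{-1},h_{-2},\dots]$, and for $n\ge 1$ let $h_{-n}$ act on $V_0$ by multiplication and $h_n$ by $\alpha^{-1}n\,\partial/\partial h_{-n}$. Let $V=V_0\otimes\mathbb C[\tfrac12\mathbb Z]$, where the group algebra $\mathbb C[\tfrac12\mathbb Z]$ has basis $e^{mh}$, $m\in\tfrac12\mathbb Z$. Define operators $X_n$ ($n\in\mathbb Z$) on $V$ by $$X(z)=\sum_{n\in\mathbb Z}X_nz^{-n}=\exp\Big(\sum_{n\ge1}\frac{z^n}{n}\alpha h_{-n}\Big)\,E(z)\,\exp\Big(\sum_{n\ge1}\frac{z^{-n}}{-n}2\alpha h_n\Big),$$ where $E(z)$ acts on the second tensor factor by $E(z)\,e^{mh}=z^{(m+1/2)2\alpha}e^{(m+1)h}$. For a finite sequence $\lambda=(\lambda_1,\dots,\lambda_l)$ of integers put $X_{-\lambda}=X_{-\lambda_1}\cdots X_{-\lambda_l}$. Let $\Lambda_{\mathbb C}$ be the ring of symmetric functions with complex coefficients in infinitely many variables, with monomial functions $m_\lambda$, power sums $p_\lambda$ and the bilinear form $\langle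 p_\lambda,p_\mu\rangle=\delta_{\lambda\mu}\,z_\lambda\,\alpha^{-l(\lambda)}$, where $z_\lambda=\prod_{i\ge1}i^{m_i}m_i!$, $m_i$ is the multiplicity of $i$ in $\lambda$, and $l(\lambda)$ is the number of nonzero parts. Let $T:V\to\Lambda_{\mathbb C}$ be the linear map with $T(h_{-\lambda_1}\cdots h_{-\lambda_l}\otimes e^{mh})=p_\lambda$. Let $P_\lambda(\alpha^{-1})\in\Lambda_{\mathbb C}$ be the Jack functions, i.e. the pairwise orthogonal family with $P_\lambda(\alpha^{-1})\in m_\lambda+\sum_{\mu<\lambda}\mathbb C\,m_\mu$ (dominance order), and let $Q_\lambda(\alpha^{-1})=\langle P_\lambda(\alpha^{-1}),P_\lambda(\alpha^{-1})\rangle^{-1}P_\lambda(\alpha^{-1})$ be the dual Jack functions. Let $k\in\mathbb Z_{\ge0}$, $s\in\mathbb Z_{>0}$, $t\in\{0,1\}$ and $r\in\mathbb Z$ with $r\alpha\le k+\delta_{t,0}$. Let $\lambda=((k+1)^s,k^t)$ be the sequence of $s$ entries $k+1$ followed by $t$ entries $k$, and $\mathbf 1=(1,\dots,1)\in\mathbb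 Z^{s+t}$. Then there is a constant $c\ne0$ such that $$T\big(X_{-\lambda}\,e^{-\frac{s+t-r}{2}h}\big)=c\,Q_{\lambda-r\alpha\mathbf 1}(\alpha^{-1}).$$ -/

import Mathlib

noncomputable section

namespace VertexJack

/-! ### Partitions -/

/-- A partition `(1^{m₁} 2^{m₂} ⋯)`, recorded by its multiplicities `mᵢ`. -/
abbrev Par : Type := ℕ+ →₀ ℕ

/-- The number of parts `l(λ) = ∑ mᵢ`. -/
def len (l : Par) : ℕ := l.sum fun _ m => m

/-- The weight `|λ| = ∑ i mᵢ`. -/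
def wt (l : Par) : ℕ := l.sum fun i m => (i : ℕ) * m

/-- `z_λ = ∏ i^{mᵢ} mᵢ!`. -/
def zee (l : Par) : ℕ := l.prod fun i m => (i : ℕ) ^ m * m.factorial

/-- The partition with the single part `a`; the empty partition if `a = 0`. -/
def part (a : ℕ) : Par := if h : 0 < a then Finsupp.single (Nat.toPNat a h) 1 else 0

/-- The partition with the given list of parts, where zeros are dropped
(only used for lists of nonnegative integers). -/
def ofParts (L : List ℤ) : Par := (L.map fun a => part a.toNat).sum

/-- The parts of a partition in weakly decreasing order. -/
def rows (l : Par) : List ℕ :=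
  ((Finsupp.toMultiset l).map fun i : ℕ+ => (i : ℕ)).sort (· ≥ ·)

/-- Dominance order `m ≤ l`. -/
def Dom (m l : Par) : Prop :=
  wt m = wt l ∧ ∀ i : ℕ, ((rows m).take i).sum ≤ ((rows l).take i).sum

/-- Strict dominance order `m < l`. -/
def SDom (m l : Par) : Prop := Dom m l ∧ m ≠ l

theorem eq_of_take_sum : ∀ (a b : List ℕ), (∀ x ∈ a, 0 < x) → (∀ x ∈ b, 0 < x) →
    (∀ i, (a.take i).sum = (b.take i).sum) → a = b
  | [], [], _, _, _ => rfl
  | [], y :: b, _, hb, h => by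
      have := h 1; have := hb y (by simp); simp at *; omega
  | x :: a, [], ha, _, h => by
      have := h 1; have := ha x (by simp); simp at *; omega
  | x :: a, y :: b, ha, hb, h => by
      have h1 : x = y := by simpa using h 1
      subst h1
      rw [eq_of_take_sum a b (fun z hz => ha z (by simp [hz])) (fun z hz => hb z (by simp [hz]))
        (fun i => by simpa using h (i + 1))]

theorem rows_pos (l : Par) : ∀ x ∈ rows l, 0 < x := by
  intro x hx
  simp only [rows, Multiset.mem_sort, Multiset.mem_map] at hx
  obtain ⟨i, -, rfl⟩ := hx
  exact i.pos

theorem rows_injective : Function.Injective rows := by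
  intro l m h
  have := congrArg (fun L : List ℕ => (L : Multiset ℕ)) h
  simp only [rows, Multiset.sort_eq] at this
  exact Function.LeftInverse.injective (g := Multiset.toFinsupp) (fun f => Finsupp.toMultiset_toFinsupp f) (Multiset.map_injective PNat.coe_injective this)

theorem Dom.antisymm {l m : Par} (h : Dom l m) (h' : Dom m l) : l = m :=
  rows_injective (eq_of_take_sum _ _ (rows_pos l) (rows_pos m)
    fun i => le_antisymm (h.2 i) (h'.2 i))

theorem Dom.trans {a b c : Par} (h : Dom a b) (h' : Dom b c) : Dom a c :=
  ⟨h.1.trans h'.1, fun i => (h.2 i).trans (h'.2 i)⟩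

theorem SDom.trans {a b c : Par} (h : SDom a b) (h' : SDom b c) : SDom a c :=
  ⟨h.1.trans h'.1, fun e => h'.2 (h'.1.antisymm (e ▸ h.1))⟩

instance : IsStrictOrder Par SDom where
  irrefl _ h := h.2 rfl
  trans _ _ _ h h' := h.trans h'

theorem finite_wt_le (n : ℕ) : {l : Par | wt l ≤ n}.Finite := by
  refine (Set.finite_Iic (∑ i ∈ Finset.Icc (1 : ℕ+) (Nat.toPNat (n + 1) n.succ_pos), Finsupp.single i n)).subset ?_
  intro l hl i
  simp only [Set.mem_ofPred_eq, wt] at hl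
  by_cases hi : l i = 0
  · simp [hi]
  have h1 : (i : ℕ) * l i ≤ n := le_trans
    (Finset.single_le_sum (f := fun i : ℕ+ => (i : ℕ) * l i) (fun _ _ => Nat.zero_le _)
      (Finsupp.mem_support_iff.2 hi)) hl
  have h2 : (i : ℕ) ≤ n := le_trans (Nat.le_mul_of_pos_right _ (Nat.pos_of_ne_zero hi)) h1
  have h3 : l i ≤ n := le_trans (Nat.le_mul_of_pos_left _ i.pos) h1
  rw [Finsupp.finsetSum_apply, Finset.sum_eq_single i]
  · simpa using h3
  · intro b _ hb; simp [hb]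
  · intro h
    exfalso; apply h
    rw [Finset.mem_Icc]
    exact ⟨one_le, PNat.coe_le_coe _ _ |>.1 (h2.trans (Nat.le_succ n))⟩

theorem finite_sdom (l : Par) : {m : Par | SDom m l}.Finite :=
  (finite_wt_le (wt l)).subset fun _ h => h.1.1.le

/-! ### Symmetric functions in infinitely many variables -/

/-- The partition formed by the nonzero exponents of the monomial `x^e`. -/
def expType (e : ℕ →₀ ℕ) : Par := e.sum fun _ a => part a

theorem wt_add (l m : Par) : wt (l + m) = wt l + wt m :=
  Finsupp.sum_add_index' (by simp) (by intros; ring)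

theorem len_add (l m : Par) : len (l + m) = len l + len m :=
  Finsupp.sum_add_index' (by simp) (by intros; ring)

theorem wt_part (a : ℕ) : wt (part a) = a := by
  unfold part; split_ifs with h
  · rw [wt, Finsupp.sum_single_index (by simp)]; exact mul_one a
  · simp [wt]; omega

theorem len_part {a : ℕ} (h : a ≠ 0) : len (part a) = 1 := by
  rw [part, dif_pos (Nat.pos_of_ne_zero h), len, Finsupp.sum_single_index rfl]

theorem wt_expType (e : ℕ →₀ ℕ) : wt (expType e) = e.degree := by
  have : ∀ s : Finset ℕ, wt (∑ i ∈ s, part (e i)) = ∑ i ∈ s, e i := by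
    intro s
    induction s using Finset.induction_on with
    | empty => simp [wt]
    | insert a s ha ih => rw [Finset.sum_insert ha, Finset.sum_insert ha, wt_add, wt_part, ih]
  exact this _

theorem len_expType (e : ℕ →₀ ℕ) : len (expType e) = e.support.card := by
  have : ∀ s : Finset ℕ, s ⊆ e.support → len (∑ i ∈ s, part (e i)) = s.card := by
    intro s
    induction s using Finset.induction_on with
    | empty => simp [len]
    | insert a s ha ih =>
      intro hs
      rw [Finset.sum_insert ha, Finset.card_insert_of_notMem ha, len_add,
        len_part (Finsupp.mem_support_iff.1 (hs (by simp))),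
        ih (fun x hx => hs (by simp [hx])), add_comm]
  exact this _ subset_rfl

theorem expType_apply (e : ℕ →₀ ℕ) (i : ℕ+) :
    expType e i = (e.support.filter fun j => e j = i).card := by
  rw [expType, Finsupp.sum, Finsupp.finsetSum_apply, Finset.card_filter]
  refine Finset.sum_congr rfl fun j hj => ?_
  have hj' : 0 < e j := Nat.pos_of_ne_zero (Finsupp.mem_support_iff.1 hj)
  rw [part, dif_pos hj', Finsupp.single_apply]
  refine if_congr ?_ rfl rfl
  rw [← PNat.coe_inj]; rfl

theorem expType_embDomain (s : Equiv.Perm ℕ) (e : ℕ →₀ ℕ) :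
    expType (Finsupp.embDomain s.toEmbedding e) = expType e := by
  rw [expType, Finsupp.sum, Finsupp.support_embDomain, Finset.sum_map]
  exact Finset.sum_congr rfl fun j _ => by rw [Finsupp.embDomain_apply_self]

theorem exists_perm {e e' : ℕ →₀ ℕ} (h : expType e = expType e') :
    ∃ s : Equiv.Perm ℕ, Finsupp.embDomain s.toEmbedding e = e' := by
  have key : ∀ c : ℕ, Nonempty ({j // e j = c} ≃ {j // e' j = c}) := by
    intro c
    rcases Nat.eq_zero_or_pos c with rfl | hc
    · have inf : ∀ f : ℕ →₀ ℕ, Infinite {j // f j = 0} := by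
        intro f
        have : {j | f j = 0} = (f.support : Set ℕ)ᶜ := by ext; simp
        have h2 : {j | f j = 0}.Infinite := this ▸ f.support.finite_toSet.infinite_compl
        exact Set.infinite_coe_iff.2 h2
      have := inf e; have := inf e'
      obtain ⟨d⟩ := nonempty_denumerable {j // e j = 0}
      obtain ⟨d'⟩ := nonempty_denumerable {j // e' j = 0}
      exact ⟨(Denumerable.eqv _).trans (Denumerable.eqv _).symm⟩
    · have fib : ∀ f : ℕ →₀ ℕ, ∀ j, f j = c ↔ j ∈ f.support.filter fun j => f j = c := by
        intro f j; simp; omega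
      have hh := DFunLike.congr_fun h (Nat.toPNat c hc)
      rw [expType_apply, expType_apply] at hh
      exact ⟨(Equiv.subtypeEquivRight (fib e)).trans
        ((Finset.equivOfCardEq hh).trans (Equiv.subtypeEquivRight (fib e')).symm)⟩
  let s : Equiv.Perm ℕ := Equiv.ofFiberEquiv fun c => (key c).some
  have hs : ∀ j, e' (s j) = e j := fun j => Equiv.ofFiberEquiv_map _ j
  refine ⟨s, Finsupp.ext fun j => ?_⟩
  obtain ⟨i, rfl⟩ := s.surjective j
  rw [hs]
  exact Finsupp.embDomain_apply_self s.toEmbedding e i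

/-- The ring `Λ_ℂ` of symmetric functions: power series of bounded degree in the variables
`x₀, x₁, x₂, …` that are invariant under all permutations of the variables. -/
def Lam : Subalgebra ℂ (MvPowerSeries ℕ ℂ) where
  carrier := {f | (∃ d : ℕ, ∀ e, MvPowerSeries.coeff e f ≠ 0 → e.degree ≤ d) ∧
    ∀ s : Equiv.Perm ℕ, MvPowerSeries.renameEquiv ℂ s f = f}
  mul_mem' := by
    rintro f g ⟨⟨d, hd⟩, hf⟩ ⟨⟨d', hd'⟩, hg⟩
    refine ⟨⟨d + d', fun e he => ?_⟩, fun s => by rw [map_mul, hf, hg]⟩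
    rw [MvPowerSeries.coeff_mul] at he
    obtain ⟨p, hp, hp'⟩ := Finset.exists_ne_zero_of_sum_ne_zero he
    rw [← Finset.HasAntidiagonal.mem_antidiagonal.1 hp, map_add]
    exact add_le_add (hd _ (left_ne_zero_of_mul hp')) (hd' _ (right_ne_zero_of_mul hp'))
  add_mem' := by
    rintro f g ⟨⟨d, hd⟩, hf⟩ ⟨⟨d', hd'⟩, hg⟩
    refine ⟨⟨max d d', fun e he => ?_⟩, fun s => by rw [map_add, hf, hg]⟩
    by_cases h : MvPowerSeries.coeff e f = 0
    · rw [map_add, h, zero_add] at he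
      exact (hd' e he).trans (le_max_right _ _)
    · exact (hd e h).trans (le_max_left _ _)
  algebraMap_mem' := by
    intro r
    refine ⟨⟨0, fun e he => ?_⟩, fun s => AlgEquiv.commutes _ r⟩
    rw [MvPowerSeries.algebraMap_apply, MvPowerSeries.coeff_C] at he
    have : e = 0 := by by_contra h; simp [h] at he
    simp [this]

theorem coeff_embDomain {f : MvPowerSeries ℕ ℂ} (hf : f ∈ Lam) (s : Equiv.Perm ℕ) (e : ℕ →₀ ℕ) :
    MvPowerSeries.coeff (Finsupp.embDomain s.toEmbedding e) f = MvPowerSeries.coeff e f := by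
  conv_lhs => rw [← hf.2 s]
  exact MvPowerSeries.coeff_embDomain_rename s.toEmbedding f e

theorem coeff_eq_of_expType {f : MvPowerSeries ℕ ℂ} (hf : f ∈ Lam) {e e' : ℕ →₀ ℕ}
    (h : expType e = expType e') : MvPowerSeries.coeff e f = MvPowerSeries.coeff e' f := by
  obtain ⟨s, rfl⟩ := exists_perm h
  exact (coeff_embDomain hf s e).symm

/-- The monomial symmetric function `m_λ`, the sum of all distinct monomials of type `λ`. -/
def mono (l : Par) : Lam := ⟨fun e => if expType e = l then 1 else 0, by
  refine ⟨⟨wt l, fun e he => ?_⟩, fun s => ?_⟩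
  · by_contra h
    refine he (if_neg ?_)
    rintro rfl
    rw [wt_expType] at h
    exact h le_rfl
  · ext e
    have h : Finsupp.embDomain s.toEmbedding (Finsupp.embDomain s.symm.toEmbedding e) = e := by
      ext j
      obtain ⟨i, rfl⟩ := s.surjective j
      obtain ⟨k, rfl⟩ := s.symm.surjective i
      erw [Finsupp.embDomain_apply_self s.toEmbedding, Finsupp.embDomain_apply_self s.symm.toEmbedding]
      simp
    rw [← h]
    refine (MvPowerSeries.coeff_embDomain_rename s.toEmbedding _ _).trans ?_
    change (if _ then _ else _) = (if _ then _ else _)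
    rw [expType_embDomain s]⟩


/-- The power sum `p_n = ∑ xᵢⁿ = m_{(n)}`. -/
def psum (n : ℕ+) : Lam := mono (Finsupp.single n 1)

/-- `p_λ = p_{λ₁} p_{λ₂} ⋯`. -/
def psumPar (l : Par) : Lam := l.prod fun n m => psum n ^ m

theorem coeff_mono (l : Par) (e : ℕ →₀ ℕ) :
    MvPowerSeries.coeff e (mono l : MvPowerSeries ℕ ℂ) = if expType e = l then 1 else 0 := rfl

theorem part_pos (n : ℕ+) : part n = Finsupp.single n 1 := by
  rw [part, dif_pos n.pos]; rfl

theorem expType_add {a b : ℕ →₀ ℕ} (h : Disjoint a.support b.support) :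
    expType (a + b) = expType a + expType b :=
  Finsupp.sum_add_index_of_disjoint h _

theorem expType_single (j : ℕ) (n : ℕ+) :
    expType (Finsupp.single j (n : ℕ)) = Finsupp.single n 1 := by
  rw [expType, Finsupp.sum_single_index (by simp [part]), part_pos]

theorem exists_expType (l : Par) : ∃ e, expType e = l := by
  obtain ⟨s, rfl⟩ := (Multiset.toFinsupp (α := ℕ+)).surjective l
  induction s using Multiset.induction_on with
  | empty => exact ⟨0, by simp [expType]⟩
  | cons n s ih =>
    obtain ⟨e, he⟩ := ih
    obtain ⟨j, hj⟩ := Infinite.exists_notMem_finset e.support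
    refine ⟨Finsupp.single j (n : ℕ) + e, ?_⟩
    rw [expType_add, expType_single, he, ← Multiset.singleton_add, map_add,
      Multiset.toFinsupp_singleton]
    rw [Finsupp.support_single _ n.ne_zero]
    simpa using hj

/-- The unitriangularity-type statement relating `p_λ` to the monomials. -/
theorem coeff_psumPar (l : Par) (e : ℕ →₀ ℕ) : ∃ k : ℕ,
    MvPowerSeries.coeff e (psumPar l : MvPowerSeries ℕ ℂ) = k ∧
    (k ≠ 0 → e.support.card ≤ len l ∧ e.degree = wt l ∧
      (e.support.card = len l → expType e = l)) ∧ (expType e = l → 0 < k) := by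
  classical
  obtain ⟨s, rfl⟩ := (Multiset.toFinsupp (α := ℕ+)).surjective l
  induction s using Multiset.induction_on generalizing e with
  | empty =>
    refine ⟨if e = 0 then 1 else 0, ?_, ?_, ?_⟩
    · simp only [map_zero, psumPar, Finsupp.prod_zero_index]
      rw [show ((1 : Lam) : MvPowerSeries ℕ ℂ) = 1 from rfl, MvPowerSeries.coeff_one]
      split_ifs <;> simp
    · intro h
      have : e = 0 := by by_contra h'; simp [h'] at h
      subst this; simp [len, wt, expType]
    · intro h
      have : e = 0 := by
        have := len_expType e
        rw [h] at this
        simpa [len] using this.symm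
      simp [this]
  | cons n s ih =>
    have hl : Multiset.toFinsupp (n ::ₘ s) = Finsupp.single n 1 + Multiset.toFinsupp s := by
      rw [← Multiset.singleton_add, map_add, Multiset.toFinsupp_singleton]
    rw [hl]
    set l := Multiset.toFinsupp s
    have hp : psumPar (Finsupp.single n 1 + l) = psum n * psumPar l := by
      rw [psumPar, Finsupp.prod_add_index' (by simp) (by intros; rw [pow_add]),
        Finsupp.prod_single_index (by simp), pow_one, psumPar]
    have hw : wt (Finsupp.single n 1 : Par) = n := by rw [← part_pos, wt_part]
    have hlen : len (Finsupp.single n 1 : Par) = 1 := by rw [← part_pos, len_part n.ne_zero]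
    choose K hK1 hK2 hK3 using ih
    refine ⟨∑ p ∈ Finset.HasAntidiagonal.antidiagonal e,
      (if expType p.1 = Finsupp.single n 1 then 1 else 0) * K p.2, ?_, ?_, ?_⟩
    · rw [hp, MulMemClass.coe_mul, MvPowerSeries.coeff_mul]
      push_cast
      refine Finset.sum_congr rfl fun p _ => ?_
      rw [hK1, psum, coeff_mono]
    · intro h
      obtain ⟨p, hp, hp'⟩ := Finset.exists_ne_zero_of_sum_ne_zero h
      have h1 : expType p.1 = Finsupp.single n 1 := by
        by_contra h'; simp [h'] at hp'
      have h2 : K p.2 ≠ 0 := right_ne_zero_of_mul hp'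
      obtain ⟨a1, a2, a3⟩ := hK2 p.2 h2
      have he := Finset.HasAntidiagonal.mem_antidiagonal.1 hp
      have c1 : p.1.support.card = 1 := by rw [← len_expType, h1, hlen]
      have d1 : p.1.degree = n := by rw [← wt_expType, h1, hw]
      have hle : e.support.card ≤ (p.1.support ∪ p.2.support).card :=
        Finset.card_le_card (he ▸ Finsupp.support_add)
      have hle2 := Finset.card_union_add_card_inter p.1.support p.2.support
      rw [len_add, wt_add, hlen, hw]
      refine ⟨by omega, by rw [← he, map_add]; omega, fun hc => ?_⟩
      have hd : Disjoint p.1.support p.2.support := by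
        rw [Finset.disjoint_iff_inter_eq_empty, ← Finset.card_eq_zero]; omega
      rw [← he, expType_add hd, h1, a3 (by omega)]
    · intro h
      have hn : expType e n ≠ 0 := by rw [h]; simp
      rw [expType_apply] at hn
      obtain ⟨j, hj⟩ := Finset.card_ne_zero.1 hn
      rw [Finset.mem_filter] at hj
      have he : Finsupp.single j (n : ℕ) + e.erase j = e := by
        rw [← hj.2]; exact Finsupp.single_add_erase j e
      have hd : Disjoint (Finsupp.single j (n : ℕ)).support (e.erase j).support := by
        rw [Finsupp.support_single _ n.ne_zero]; simp
      have h2 : expType (e.erase j) = l := by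
        rw [← he, expType_add hd, expType_single] at h
        exact add_left_cancel h
      have hmem : (Finsupp.single j (n : ℕ), e.erase j) ∈ Finset.HasAntidiagonal.antidiagonal e :=
        Finset.HasAntidiagonal.mem_antidiagonal.2 he
      refine lt_of_lt_of_le ?_ (Finset.single_le_sum
        (f := fun p : (ℕ →₀ ℕ) × (ℕ →₀ ℕ) =>
          (if expType p.1 = Finsupp.single n 1 then 1 else 0) * K p.2)
        (fun _ _ => Nat.zero_le _) hmem)
      simp only [expType_single, if_true, one_mul]
      exact hK3 _ h2

/-- The algebra map `h_{-n} ↦ p_n`. -/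
def toLam : MvPolynomial ℕ+ ℂ →ₐ[ℂ] Lam := MvPolynomial.aeval psum

theorem toLam_monomial (l : Par) (c : ℂ) : toLam (MvPolynomial.monomial l c) = c • psumPar l := by
  rw [toLam, MvPolynomial.aeval_monomial, Algebra.smul_def]; rfl

theorem toLam_eq_sum (F : MvPolynomial ℕ+ ℂ) :
    toLam F = ∑ l ∈ F.support, MvPolynomial.coeff l F • psumPar l := by
  conv_lhs => rw [F.as_sum, map_sum]
  simp only [toLam_monomial]

theorem toLam_injective : Function.Injective toLam := by
  rw [injective_iff_map_eq_zero]
  intro F hF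
  by_contra hne
  obtain ⟨l, hl, hmax⟩ := F.support.exists_max_image len (by
    simpa [Finset.nonempty_iff_ne_empty, MvPolynomial.support_eq_empty] using hne)
  obtain ⟨e, he⟩ := exists_expType l
  have h0 : MvPowerSeries.coeff e (toLam F : MvPowerSeries ℕ ℂ) = 0 := by rw [hF]; simp
  rw [toLam_eq_sum] at h0
  rw [AddSubmonoidClass.coe_finsetSum, map_sum, Finset.sum_eq_single l] at h0
  · obtain ⟨k, h1, -, h3⟩ := coeff_psumPar l e
    rw [Subalgebra.coe_smul, MvPowerSeries.coeff_smul, h1] at h0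
    have := h3 he
    rcases mul_eq_zero.1 h0 with h | h
    · exact MvPolynomial.mem_support_iff.1 hl h
    · exact this.ne' (by exact_mod_cast h)
  · intro m hm hml
    obtain ⟨k, h1, h2, -⟩ := coeff_psumPar m e
    rw [Subalgebra.coe_smul, MvPowerSeries.coeff_smul, h1]
    by_cases hk : k = 0
    · simp [hk]
    · obtain ⟨a1, -, a3⟩ := h2 hk
      have := hmax m hm
      have hc : e.support.card = len l := by rw [← len_expType, he]
      exact absurd ((a3 (by omega)).symm.trans he) hml
  · intro h; exact absurd hl h

theorem coeff_eq_zero_of_wt (f : Lam) : ∃ d : ℕ, ∀ e, d < wt (expType e) →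
    MvPowerSeries.coeff e (f : MvPowerSeries ℕ ℂ) = 0 := by
  obtain ⟨d, hd⟩ := f.2.1
  refine ⟨d, fun e he => ?_⟩
  by_contra h
  rw [wt_expType] at he
  exact absurd (hd e h) (by omega)

/-- Every symmetric function is a linear combination of the `m_λ`. -/
theorem eq_sum_mono (f : Lam) (S : Finset Par)
    (hS : ∀ e, expType e ∉ S → MvPowerSeries.coeff e (f : MvPowerSeries ℕ ℂ) = 0) :
    f = ∑ l ∈ S, MvPowerSeries.coeff (exists_expType l).choose (f : MvPowerSeries ℕ ℂ) • mono l := by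
  refine Subtype.ext (MvPowerSeries.ext fun e => ?_)
  rw [AddSubmonoidClass.coe_finsetSum, map_sum]
  simp only [Subalgebra.coe_smul, MvPowerSeries.coeff_smul, coeff_mono]
  by_cases he : expType e ∈ S
  · rw [Finset.sum_eq_single (expType e)]
    · rw [if_pos rfl, mul_one]
      exact coeff_eq_of_expType f.2 (exists_expType (expType e)).choose_spec.symm
    · intro m _ hm; rw [if_neg hm.symm, mul_zero]
    · intro h; exact absurd he h
  · rw [hS e he, Finset.sum_eq_zero]
    intro m hm
    rw [if_neg (fun h : expType e = m => he (h ▸ hm)), mul_zero]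

theorem mono_mem_range (l : Par) : mono l ∈ toLam.range := by
  induction hn : len l using Nat.strong_induction_on generalizing l with
  | _ n ih =>
    obtain ⟨e, he⟩ := exists_expType l
    obtain ⟨k, h1, -, h3⟩ := coeff_psumPar l e
    have hk : (k : ℂ) ≠ 0 := by exact_mod_cast (h3 he).ne'
    have hf : psumPar l ∈ toLam.range := ⟨MvPolynomial.monomial l 1, by
      exact (toLam_monomial l 1).trans (one_smul _ _)⟩
    set S := (finite_wt_le (wt l)).toFinset.filter fun m => len m < n with hSdef
    have key := eq_sum_mono (psumPar l - (k : ℂ) • mono l) S (by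
      intro e' he'
      rw [AddSubgroupClass.coe_sub, map_sub, Subalgebra.coe_smul, MvPowerSeries.coeff_smul,
        coeff_mono]
      by_cases ht : expType e' = l
      · rw [if_pos ht, mul_one, ← h1, coeff_eq_of_expType (psumPar l).2 (ht.trans he.symm), sub_self]
      · rw [if_neg ht, mul_zero, sub_zero]
        obtain ⟨k', b1, b2, -⟩ := coeff_psumPar l e'
        rw [b1]
        by_contra hk'
        obtain ⟨c1, c2, c3⟩ := b2 (by exact_mod_cast hk')
        apply he'
        rw [hSdef, Finset.mem_filter, Set.Finite.mem_toFinset]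
        refine ⟨(by rw [wt_expType, c2] : wt (expType e') = wt l).le, ?_⟩
        rw [len_expType, ← hn]
        exact lt_of_le_of_ne c1 fun h => ht (c3 h))
    have hr : psumPar l - (k : ℂ) • mono l ∈ toLam.range := by
      rw [key]
      refine sum_mem fun m hm => Subalgebra.smul_mem _ (ih (len m) ?_ m rfl) _
      exact (Finset.mem_filter.1 hm).2
    have := Subalgebra.smul_mem _ (sub_mem hf hr) ((k : ℂ)⁻¹)
    rwa [sub_sub_cancel, smul_smul, inv_mul_cancel₀ hk, one_smul] at this

theorem toLam_surjective : Function.Surjective toLam := by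
  intro f
  obtain ⟨d, hd⟩ := coeff_eq_zero_of_wt f
  have key := eq_sum_mono f (finite_wt_le d).toFinset (by
    intro e he
    apply hd
    by_contra h
    exact he ((Set.Finite.mem_toFinset _).2 (not_lt.1 h)))
  have : f ∈ toLam.range := by
    rw [key]
    exact sum_mem fun m _ => Subalgebra.smul_mem _ (mono_mem_range m) _
  exact this

/-- The power sum products `p_λ` form a basis of `Λ_ℂ`. -/
def psumBasis : Module.Basis Par ℂ Lam :=
  (MvPolynomial.basisMonomials ℕ+ ℂ).map
    (AlgEquiv.ofBijective toLam ⟨toLam_injective, toLam_surjective⟩).toLinearEquiv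

theorem psumBasis_apply (l : Par) : psumBasis l = psumPar l := by
  rw [psumBasis, Module.Basis.map_apply, MvPolynomial.coe_basisMonomials]
  exact (toLam_monomial l 1).trans (one_smul _ _)


/-! ### Jack functions -/

/-- The scalar product `⟨p_λ, p_μ⟩ = δ_{λμ} z_λ α^{-l(λ)}` on `Λ_ℂ`. -/
def scal (α : ℕ) : LinearMap.BilinForm ℂ Lam :=
  psumBasis.constr ℂ fun l => ((zee l : ℂ) * ((α : ℂ) ^ len l)⁻¹) • psumBasis.coord l

/-- A Jack family `P_λ(α⁻¹)`: `P_λ = m_λ + ∑_{μ<λ} c_{λμ} m_μ`, and the `P_λ` are pairwise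
orthogonal. -/
structure IsJackFamily (α : ℕ) (P : Par → Lam) : Prop where
  triangular : ∀ l, P l - mono l ∈ Submodule.span ℂ (mono '' {m | SDom m l})
  orthogonal : ∀ l m, l ≠ m → scal α (P l) (P m) = 0

/-- The characterization of a single `P_λ(α⁻¹)`: it is `m_λ` plus a combination of the `m_μ` with
`μ < λ`, and it is orthogonal to the span of these `m_μ` (which is the span of the `P_μ`,
`μ < λ`). -/
def IsJackP (α : ℕ) (l : Par) (f : Lam) : Prop :=
  f - mono l ∈ Submodule.span ℂ (mono '' {m | SDom m l}) ∧
    ∀ m, SDom m l → scal α f (mono m) = 0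

theorem scal_apply (α : ℕ) (f g : Lam) : scal α f g = (psumBasis.repr f).sum fun l c =>
    c * (((zee l : ℂ) * ((α : ℂ) ^ len l)⁻¹) * psumBasis.repr g l) := by
  rw [scal, Module.Basis.constr_apply, Finsupp.sum, LinearMap.sum_apply]
  rfl

theorem scal_psumPar (α : ℕ) (l m : Par) : scal α (psumPar l) (psumPar m) =
    if l = m then (zee l : ℂ) * ((α : ℂ) ^ len l)⁻¹ else 0 := by
  classical
  rw [← psumBasis_apply, ← psumBasis_apply, scal, Module.Basis.constr_basis, LinearMap.smul_apply,
    Module.Basis.coord_apply, Module.Basis.repr_self, Finsupp.single_apply]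
  split_ifs with h1 h2 h2
  · simp
  · exact absurd h1.symm h2
  · exact absurd h2.symm h1
  · simp

theorem exists_conj (f : Lam) : ∃ g : Lam,
    (∀ e, MvPowerSeries.coeff e (g : MvPowerSeries ℕ ℂ) =
      starRingEnd ℂ (MvPowerSeries.coeff e (f : MvPowerSeries ℕ ℂ))) ∧
    ∀ l, psumBasis.repr g l = starRingEnd ℂ (psumBasis.repr f l) := by
  refine ⟨psumBasis.repr.symm ((psumBasis.repr f).mapRange (starRingEnd ℂ) (map_zero _)), ?_, ?_⟩
  · intro e
    conv_rhs => rw [← psumBasis.repr.symm_apply_apply f]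
    rw [Module.Basis.repr_symm_apply, Module.Basis.repr_symm_apply,
      Finsupp.linearCombination_apply, Finsupp.linearCombination_apply,
      Finsupp.sum_mapRange_index (by simp), Finsupp.sum, Finsupp.sum,
      AddSubmonoidClass.coe_finsetSum, AddSubmonoidClass.coe_finsetSum, map_sum, map_sum, map_sum]
    refine Finset.sum_congr rfl fun l _ => ?_
    obtain ⟨k, hk, -⟩ := coeff_psumPar l e
    rw [Subalgebra.coe_smul, Subalgebra.coe_smul, MvPowerSeries.coeff_smul,
      MvPowerSeries.coeff_smul, psumBasis_apply, hk, map_mul, map_natCast]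
  · intro l
    simp

theorem eq_zero_of_orthogonal {α : ℕ} (hα : 0 < α) (A : Set Par) {w : Lam}
    (hw : w ∈ Submodule.span ℂ (mono '' A)) (h : ∀ m ∈ A, scal α w (mono m) = 0) : w = 0 := by
  obtain ⟨g, hg, hg'⟩ := exists_conj w
  have hgW : g ∈ Submodule.span ℂ (mono '' A) := by
    have : ∃ g' ∈ Submodule.span ℂ (mono '' A), ∀ e,
        MvPowerSeries.coeff e (g' : MvPowerSeries ℕ ℂ) =
          starRingEnd ℂ (MvPowerSeries.coeff e (w : MvPowerSeries ℕ ℂ)) := by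
      clear hg hg' h
      induction hw using Submodule.span_induction with
      | mem x hx =>
        refine ⟨x, Submodule.subset_span hx, fun e => ?_⟩
        obtain ⟨m, -, rfl⟩ := hx
        rw [coeff_mono]
        split_ifs <;> simp
      | zero => exact ⟨0, zero_mem _, fun e => by simp⟩
      | add x y _ _ hx hy =>
        obtain ⟨a, ha, ha'⟩ := hx
        obtain ⟨b, hb, hb'⟩ := hy
        exact ⟨a + b, add_mem ha hb, fun e => by
          rw [AddMemClass.coe_add, AddMemClass.coe_add, map_add, map_add, map_add, ha', hb']⟩
      | smul c x _ hx =>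
        obtain ⟨a, ha, ha'⟩ := hx
        exact ⟨starRingEnd ℂ c • a, Submodule.smul_mem _ _ ha, fun e => by
          rw [Subalgebra.coe_smul, Subalgebra.coe_smul, MvPowerSeries.coeff_smul,
            MvPowerSeries.coeff_smul, map_mul, ha']⟩
    obtain ⟨g', h1, h2⟩ := this
    have : g = g' := Subtype.ext (MvPowerSeries.ext fun e => by rw [hg, h2])
    rwa [this]
  have h0 : scal α w g = 0 := by
    clear hg hg'
    induction hgW using Submodule.span_induction with
    | mem x hx => obtain ⟨m, hm, rfl⟩ := hx; exact h m hm
    | zero => simp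
    | add x y _ _ hx hy => rw [map_add, hx, hy, add_zero]
    | smul c x _ hx => rw [map_smul, hx, smul_zero]
  rw [scal_apply, Finsupp.sum] at h0
  have h1 : ∀ l, psumBasis.repr w l * (((zee l : ℂ) * ((α : ℂ) ^ len l)⁻¹) *
      psumBasis.repr g l) = ((Complex.normSq (psumBasis.repr w l) *
        ((zee l : ℝ) * ((α : ℝ) ^ len l)⁻¹) : ℝ) : ℂ) := by
    intro l
    rw [hg']
    push_cast
    rw [← Complex.mul_conj]; ring
  simp only [h1] at h0
  rw [← Complex.ofReal_sum, Complex.ofReal_eq_zero] at h0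
  have hpos : ∀ l, 0 < (zee l : ℝ) * ((α : ℝ) ^ len l)⁻¹ := by
    intro l
    have h1 : 0 < zee l := Finset.prod_pos fun i _ => by
      have := i.pos
      positivity
    have h2 : (0 : ℝ) < α := by exact_mod_cast hα
    have h3 : (0 : ℝ) < zee l := by exact_mod_cast h1
    positivity
  rw [Finset.sum_eq_zero_iff_of_nonneg
    (fun l _ => mul_nonneg (Complex.normSq_nonneg _) (hpos l).le)] at h0
  apply psumBasis.repr.injective
  rw [map_zero]
  ext l
  by_contra hl
  have := h0 l (Finsupp.mem_support_iff.2 hl)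
  rcases mul_eq_zero.1 this with h | h
  · exact hl (Complex.normSq_eq_zero.1 h)
  · exact (hpos l).ne' h

theorem IsJackP.unique {α : ℕ} (hα : 0 < α) {l : Par} {f g : Lam} (hf : IsJackP α l f)
    (hg : IsJackP α l g) : f = g := by
  refine sub_eq_zero.1 (eq_zero_of_orthogonal hα {m | SDom m l} ?_ ?_)
  · have := sub_mem hf.1 hg.1
    rwa [sub_sub_sub_cancel_right] at this
  · intro m hm
    rw [map_sub, LinearMap.sub_apply, hf.2 m hm, hg.2 m hm, sub_zero]

theorem surjective_to_dual {W : Type*} [AddCommGroup W] [Module ℂ W] [FiniteDimensional ℂ W]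
    (φ : W →ₗ[ℂ] Module.Dual ℂ W) (h : Function.Injective φ) : Function.Surjective φ :=
  (LinearMap.injective_iff_surjective_of_finrank_eq_finrank
    (Subspace.dual_finrank_eq (K := ℂ) (V := W)).symm).1 h

theorem exists_isJackP {α : ℕ} (hα : 0 < α) (l : Par) : ∃ f, IsJackP α l f := by
  set W := Submodule.span ℂ (mono '' {m | SDom m l}) with hW
  have : FiniteDimensional ℂ W :=
    FiniteDimensional.span_of_finite ℂ ((finite_sdom l).image _)
  let φ : W →ₗ[ℂ] Module.Dual ℂ W := ((scal α).compl₁₂ W.subtype W.subtype)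
  have hinj : Function.Injective φ := by
    rw [injective_iff_map_eq_zero]
    intro w hw
    refine Subtype.ext (eq_zero_of_orthogonal hα _ w.2 fun m hm => ?_)
    exact DFunLike.congr_fun hw ⟨mono m, Submodule.subset_span ⟨m, hm, rfl⟩⟩
  have hsurj : Function.Surjective φ := surjective_to_dual (W := W) φ hinj
  obtain ⟨w, hw⟩ := hsurj ((scal α (mono l)).comp W.subtype)
  refine ⟨mono l - w, ?_, fun m hm => ?_⟩
  · rw [sub_sub_cancel_left]
    exact neg_mem w.2
  · have h1 : scal α w (mono m) = scal α (mono l) (mono m) :=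
      DFunLike.congr_fun hw ⟨mono m, Submodule.subset_span ⟨m, hm, rfl⟩⟩
    rw [map_sub, LinearMap.sub_apply, h1, sub_self]

/-- The Jack function `P_λ(α⁻¹)`. -/
def jackP (α : ℕ) (l : Par) : Lam := Classical.epsilon (IsJackP α l)

/-- The dual Jack function `Q_λ(α⁻¹) = ⟨P_λ, P_λ⟩⁻¹ P_λ`. -/
def jackQ (α : ℕ) (l : Par) : Lam := (scal α (jackP α l) (jackP α l))⁻¹ • jackP α l

theorem isJackP_jackP {α : ℕ} (hα : 0 < α) (l : Par) : IsJackP α l (jackP α l) :=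
  Classical.epsilon_spec (exists_isJackP hα l)

/-- Every Jack family consists of the functions `jackP α l`. -/
theorem IsJackFamily.eq_jackP {α : ℕ} (hα : 0 < α) {P : Par → Lam} (hP : IsJackFamily α P)
    (l : Par) : P l = jackP α l := by
  refine IsJackP.unique hα ⟨hP.triangular l, fun m hm => ?_⟩ (isJackP_jackP hα l)
  have wf := (finite_sdom l).wellFoundedOn (r := SDom)
  refine wf.induction hm (P := fun m => scal α (P l) (mono m) = 0) fun m hm ih => ?_
  have h1 : mono m = P m - (P m - mono m) := (sub_sub_cancel _ _).symm
  rw [h1, map_sub, hP.orthogonal l m (fun h => hm.2 h.symm), zero_sub, neg_eq_zero]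
  have ht := hP.triangular m
  generalize P m - mono m = y at ht ⊢
  induction ht using Submodule.span_induction with
  | mem x hx => obtain ⟨n, hn, rfl⟩ := hx; exact ih n (SDom.trans hn hm) hn
  | zero => simp
  | add x y _ _ hx hy => rw [map_add, hx, hy, add_zero]
  | smul c x _ hx => rw [map_smul, hx, smul_zero]

/-! ### The Fock space and the vertex operators -/

/-- `V₀ = Sym(h_{-1}, h_{-2}, …)`; the variable with index `n` is `h_{-n}`. -/
abbrev V0 : Type := MvPolynomial ℕ+ ℂ

/-- `V = V₀ ⊗ ℂ[½ℤ]`: the component with index `j : ℤ` is `V₀ ⊗ e^{(j/2)h}`. -/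
abbrev V : Type := ℤ →₀ V0

/-- The vector `1 ⊗ e^{(j/2)h}`. -/
def expVec (j : ℤ) : V := Finsupp.single j 1

/-- The linear map `T : V → Λ_ℂ`, `h_{-λ} ⊗ e^{sh} ↦ p_λ`. -/
def T : V →ₗ[ℂ] Lam := Finsupp.lsum ℂ fun _ => toLam.toLinearMap

/-- The action of `h_{-n}` (`n > 0`) on `V₀`: multiplication by `h_{-n}`. -/
def heisNeg (n : ℕ+) : Module.End ℂ V0 := LinearMap.mulLeft ℂ (MvPolynomial.X n)

/-- The action of `h_n` (`n > 0`) on `V₀`: `α⁻¹ n ∂/∂h_{-n}`. -/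
def heisPos (α : ℕ) (n : ℕ+) : Module.End ℂ V0 :=
  ((α : ℂ)⁻¹ * (n : ℕ)) • (MvPolynomial.pderiv n).toLinearMap

/-- The power series `∑_{n ≥ 1} a n uⁿ`. -/
def posSeries {A : Type*} [Ring A] (a : ℕ+ → A) : PowerSeries A :=
  PowerSeries.mk fun n => if h : 0 < n then a (Nat.toPNat n h) else 0

/-- `exp f = ∑ₖ fᵏ / k!` for a power series `f` without constant term
(so that only `k ≤ n` contributes to the coefficient of `uⁿ`). -/
def expSeries {A : Type*} [Ring A] [Algebra ℂ A] (f : PowerSeries A) : PowerSeries A :=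
  PowerSeries.mk fun n =>
    ∑ k ∈ Finset.range (n + 1), ((k.factorial : ℂ)⁻¹) • PowerSeries.coeff n (f ^ k)

/-- `exp (∑_{n ≥ 1} (zⁿ / n) α h_{-n})`, a power series in `z`. -/
def creation (α : ℕ) : PowerSeries (Module.End ℂ V0) :=
  expSeries (posSeries fun n => ((α : ℂ) / (n : ℕ)) • heisNeg n)

/-- `exp (∑_{n ≥ 1} (z^{-n} / (-n)) 2 α h_n)`, a power series in `z⁻¹`. -/
def annihilation (α : ℕ) : PowerSeries (Module.End ℂ V0) :=
  expSeries (posSeries fun n => (-(2 * (α : ℂ)) / (n : ℕ)) • heisPos α n)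

/-- Polynomials all of whose monomials have weight less than `d`. -/
def below (d : ℕ) : Submodule ℂ V0 := Submodule.span ℂ
  {f | ∃ l : Par, wt l < d ∧ f = MvPolynomial.monomial l 1}

theorem exists_below (f : V0) : ∃ d, f ∈ below d := by
  refine ⟨f.support.sup wt + 1, ?_⟩
  have h : ∑ l ∈ f.support, MvPolynomial.monomial l (MvPolynomial.coeff l f) ∈
      below (f.support.sup wt + 1) := ?_
  · rwa [← f.as_sum] at h
  refine sum_mem fun l hl => ?_
  rw [← mul_one (MvPolynomial.coeff l f), ← smul_eq_mul, ← MvPolynomial.smul_monomial]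
  exact Submodule.smul_mem _ _ (Submodule.subset_span
    ⟨l, Nat.lt_succ_of_le (Finset.le_sup hl), rfl⟩)

theorem below_zero {f : V0} (h : f ∈ below 0) : f = 0 := by
  have : {f : V0 | ∃ l : Par, wt l < 0 ∧ f = MvPolynomial.monomial l 1} = ∅ := by
    ext; simp
  rw [below, this, Submodule.span_empty] at h
  exact h

theorem below_mono {a b : ℕ} (h : a ≤ b) : below a ≤ below b :=
  Submodule.span_mono fun _ ⟨l, hl, hf⟩ => ⟨l, hl.trans_le h, hf⟩

/-- The operator `A` lowers the weight by at least `b`. -/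
def Lowers (b : ℕ) (A : Module.End ℂ V0) : Prop := ∀ d, ∀ f ∈ below d, A f ∈ below (d - b)

theorem lowers_heisPos (α : ℕ) (n : ℕ+) : Lowers n (heisPos α n) := by
  intro d f hf
  induction hf using Submodule.span_induction with
  | mem x hx =>
    obtain ⟨l, hl, rfl⟩ := hx
    refine Submodule.smul_mem _ _ ?_
    change MvPolynomial.pderiv n (MvPolynomial.monomial l 1) ∈ _
    rw [MvPolynomial.pderiv_monomial, one_mul]
    by_cases h : l n = 0
    · rw [h, Nat.cast_zero, MvPolynomial.monomial_zero]; exact zero_mem _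
    · rw [← mul_one ((l n : ℂ)), ← smul_eq_mul, ← MvPolynomial.smul_monomial]
      refine Submodule.smul_mem _ _ (Submodule.subset_span ⟨_, ?_, rfl⟩)
      have h1 : l - Finsupp.single n 1 + Finsupp.single n 1 = l :=
        tsub_add_cancel_of_le (Finsupp.single_le_iff.2 (Nat.one_le_iff_ne_zero.2 h))
      have h2 := congrArg wt h1
      rw [wt_add, ← part_pos, wt_part] at h2
      rw [← part_pos]; omega
  | zero => rw [map_zero]; exact zero_mem _
  | add x y _ _ hx hy => rw [map_add]; exact add_mem hx hy
  | smul c x _ hx => rw [map_smul]; exact Submodule.smul_mem _ _ hx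

theorem lowers_annihilation (α b : ℕ) : Lowers b (PowerSeries.coeff b (annihilation α)) := by
  have h1 : ∀ k b, Lowers b (PowerSeries.coeff b
      ((posSeries fun n => (-(2 * (α : ℂ)) / (n : ℕ)) • heisPos α n) ^ k)) := by
    intro k
    induction k with
    | zero =>
      intro b d f hf
      rw [pow_zero, PowerSeries.coeff_one]
      split_ifs with h
      · subst h; exact hf
      · exact zero_mem _
    | succ k ih =>
      intro b d f hf
      rw [pow_succ, PowerSeries.coeff_mul, LinearMap.sum_apply]
      refine sum_mem fun p hp => ?_
      have hp' := Finset.HasAntidiagonal.mem_antidiagonal.1 hp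
      have : d - b = d - p.2 - p.1 := by omega
      rw [this]
      refine ih p.1 _ _ ?_
      rw [posSeries, PowerSeries.coeff_mk]
      split_ifs with h
      · exact Submodule.smul_mem _ _ (lowers_heisPos α (Nat.toPNat p.2 h) d f hf)
      · exact zero_mem _
  intro d f hf
  rw [annihilation, expSeries, PowerSeries.coeff_mk, LinearMap.sum_apply]
  exact sum_mem fun k _ => Submodule.smul_mem _ _ (h1 k b d f hf)

theorem finite_support (α : ℕ) (c : ℤ) (f : V0) :
    (Function.support fun p : {p : ℕ × ℕ // (p.1 : ℤ) - p.2 = c} =>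
      PowerSeries.coeff p.1.1 (creation α) (PowerSeries.coeff p.1.2 (annihilation α) f)).Finite := by
  obtain ⟨d, hd⟩ := exists_below f
  refine Set.Finite.of_finite_image (f := fun p => p.1.2) ((Set.finite_Iio d).subset ?_) ?_
  · rintro _ ⟨p, hp, rfl⟩
    by_contra h
    apply hp
    have h1 := lowers_annihilation α p.1.2 d f hd
    have h2 : d - p.1.2 = 0 := by simp at h; omega
    rw [h2] at h1
    change PowerSeries.coeff p.1.1 (creation α) (PowerSeries.coeff p.1.2 (annihilation α) f) = 0
    rw [below_zero h1, map_zero]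
  · rintro ⟨⟨a, b⟩, hp⟩ - ⟨⟨a', b'⟩, hp'⟩ - h
    simp only at h hp hp'
    simp only [Subtype.mk.injEq, Prod.mk.injEq]
    omega

/-- The coefficient of `z^c` in
`exp (∑ (zⁿ / n) α h_{-n}) exp (∑ (z^{-n} / (-n)) 2 α h_n)`, as an operator on `V₀`. -/
def normalCoeff (α : ℕ) (c : ℤ) : Module.End ℂ V0 where
  toFun f := ∑ᶠ p : {p : ℕ × ℕ // (p.1 : ℤ) - p.2 = c},
    PowerSeries.coeff p.1.1 (creation α) (PowerSeries.coeff p.1.2 (annihilation α) f)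
  map_add' f g := by
    simp only [map_add]
    exact finsum_add_distrib (finite_support α c f) (finite_support α c g)
  map_smul' r f := by
    simp only [map_smul, RingHom.id_apply]
    exact (smul_finsum _ _).symm

/-- The component `X_n` of `X(z) = ∑ X_n z^{-n}`. The middle factor of `X(z)` sends `e^{(j/2)h}` to
`z^{(j/2 + 1/2) 2α} e^{(j/2 + 1)h}`, where `(j/2 + 1/2) 2α = (j + 1) α`. -/
def X (α : ℕ) (n : ℤ) : Module.End ℂ V :=
  Finsupp.lsum ℂ fun j : ℤ =>
    Finsupp.lsingle (j + 2) ∘ₗ normalCoeff α (-n - (j + 1) * α)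

/-- `X_{-λ} = X_{-λ₁} X_{-λ₂} ⋯ X_{-λ_l}`. -/
def XProd (α : ℕ) (L : List ℤ) : Module.End ℂ V := (L.map fun a => X α (-a)).prod

/-- The parts of `((k+1)^s, k^t)`, as a list of length `s + t`. -/
def shape (k s t : ℕ) : List ℤ := List.replicate s ((k : ℤ) + 1) ++ List.replicate t (k : ℤ)

end VertexJack

end

noncomputable section

namespace VertexJack

open PowerSeries (coeff)

/-! ### Exponentials of power series -/

theorem coeff_pow_of_lt {A : Type*} [Ring A] {f : PowerSeries A} (hf : coeff 0 f = 0) :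
    ∀ {k n : ℕ}, n < k → coeff n (f ^ k) = 0 := by
  intro k
  induction k with
  | zero => intro n h; omega
  | succ k ih =>
    intro n h
    rw [pow_succ, PowerSeries.coeff_mul]
    refine Finset.sum_eq_zero fun p hp => ?_
    have hp' := Finset.HasAntidiagonal.mem_antidiagonal.1 hp
    by_cases h2 : p.2 = 0
    · rw [h2, hf, mul_zero]
    · rw [ih (by omega), zero_mul]

theorem coeff_expSeries {A : Type*} [Ring A] [Algebra ℂ A] {f : PowerSeries A}
    (hf : coeff 0 f = 0) {n M : ℕ} (h : n < M) :
    coeff n (expSeries f) = ∑ k ∈ Finset.range M, ((k.factorial : ℂ)⁻¹) • coeff n (f ^ k) := by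
  rw [expSeries, PowerSeries.coeff_mk]
  refine Finset.sum_subset (Finset.range_mono h) fun k _ hk => ?_
  rw [coeff_pow_of_lt hf (by simpa using hk), smul_zero]

theorem coeff_zero_expSeries {A : Type*} [Ring A] [Algebra ℂ A] (f : PowerSeries A) :
    coeff 0 (expSeries f) = 1 := by
  simp [expSeries]

theorem coeff_posSeries {A : Type*} [Ring A] (a : ℕ+ → A) (n : ℕ+) :
    coeff (n : ℕ) (posSeries a) = a n := by
  rw [posSeries, PowerSeries.coeff_mk, dif_pos n.pos]; rfl

theorem coeff_zero_posSeries {A : Type*} [Ring A] (a : ℕ+ → A) :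
    coeff 0 (posSeries a) = 0 := by
  rw [posSeries, PowerSeries.coeff_mk, dif_neg (lt_irrefl 0)]

theorem factorial_inv_succ_mul (k : ℕ) :
    ((k + 1).factorial : ℂ)⁻¹ * ((k + 1 : ℕ) : ℂ) = (k.factorial : ℂ)⁻¹ := by
  have h1 : (k.factorial : ℂ) ≠ 0 := by exact_mod_cast k.factorial_ne_zero
  have h2 : ((k + 1 : ℕ) : ℂ) ≠ 0 := by exact_mod_cast k.succ_ne_zero
  rw [Nat.factorial_succ]
  push_cast at *
  field_simp

/-- The chain rule `δ (exp f) = exp f * δ f`. -/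
theorem derivation_expSeries {R : Type*} [CommRing R] [Algebra ℂ R]
    (δ : Derivation ℂ (PowerSeries R) (PowerSeries R))
    (hδ : ∀ (h : PowerSeries R) (n : ℕ), (∀ m ≤ n, coeff m h = 0) → coeff n (δ h) = 0)
    {f : PowerSeries R} (hf : coeff 0 f = 0) : δ (expSeries f) = expSeries f * δ f := by
  have hf' : coeff 0 (δ f) = 0 := hδ f 0 fun m hm => by rwa [Nat.le_zero.1 hm]
  ext n
  set S : ℕ → PowerSeries R := fun M => ∑ k ∈ Finset.range M, ((k.factorial : ℂ)⁻¹) • f ^ k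
  have hS : ∀ m ≤ n, ∀ M, n < M + 1 → coeff m (expSeries f - S (M + 1)) = 0 := by
    intro m hm M hM
    rw [map_sub, coeff_expSeries hf (hm.trans_lt hM), map_sum, sub_eq_zero]
    simp
  have h1 : coeff n (δ (expSeries f)) = coeff n (δ (S (n + 1))) := by
    rw [← sub_eq_zero, ← map_sub, ← map_sub]
    exact hδ _ _ fun m hm => hS m hm n (by omega)
  have h2 : δ (S (n + 1)) = S n * δ f := by
    simp only [S]
    rw [Finset.sum_range_succ', map_add, map_sum, Finset.sum_mul, pow_zero, Derivation.map_smul,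
      Derivation.map_one_eq_zero, smul_zero, add_zero]
    refine Finset.sum_congr rfl fun k _ => ?_
    rw [Derivation.map_smul, Derivation.leibniz_pow, add_tsub_cancel_right, ← Nat.cast_smul_eq_nsmul ℂ, smul_smul,
      factorial_inv_succ_mul, smul_eq_mul, smul_mul_assoc]
  rw [h1, h2, ← sub_eq_zero, ← map_sub, ← sub_mul, PowerSeries.coeff_mul]
  refine Finset.sum_eq_zero fun p hp => ?_
  have hp' := Finset.HasAntidiagonal.mem_antidiagonal.1 hp
  by_cases h : p.2 = 0
  · rw [h, hf', mul_zero]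
  · rw [map_sub, coeff_expSeries hf (show p.1 < n by omega)]
    simp [S]

/-- `u d/du` on power series. -/
def euler (R : Type*) [CommRing R] [Algebra ℂ R] :
    Derivation ℂ (PowerSeries R) (PowerSeries R) :=
  ((PowerSeries.X : PowerSeries R) • PowerSeries.derivative R).restrictScalars ℂ

theorem coeff_euler {R : Type*} [CommRing R] [Algebra ℂ R] (f : PowerSeries R) (n : ℕ) :
    coeff n (euler R f) = n * coeff n f := by
  change coeff n (PowerSeries.X * PowerSeries.derivative R f) = _
  cases n with
  | zero => simp
  | succ n => rw [PowerSeries.coeff_succ_X_mul, PowerSeries.coeff_derivative]; push_cast; ring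

theorem euler_expSeries {R : Type*} [CommRing R] [Algebra ℂ R] {f : PowerSeries R}
    (hf : coeff 0 f = 0) : euler R (expSeries f) = expSeries f * euler R f :=
  derivation_expSeries _ (fun h n hn => by rw [coeff_euler, hn n le_rfl, mul_zero]) hf

/-- A derivation applied to all coefficients of a power series. -/
def coeffDer {R : Type*} [CommRing R] [Algebra ℂ R] (D : Derivation ℂ R R) :
    Derivation ℂ (PowerSeries R) (PowerSeries R) :=
  Derivation.mk'
    { toFun := fun f => PowerSeries.mk fun n => D (coeff n f)
      map_add' := fun f g => by ext; simp
      map_smul' := fun c f => by ext; simp }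
    (by
      intro f g
      ext n
      simp only [LinearMap.coe_mk, AddHom.coe_mk, PowerSeries.coeff_mk, smul_eq_mul, map_add,
        PowerSeries.coeff_mul, map_sum, Derivation.leibniz, Finset.sum_add_distrib]
      congr 1
      exact (Finset.sum_equiv (Equiv.prodComm ℕ ℕ) (by simp [add_comm]) (by simp)))

theorem coeff_coeffDer {R : Type*} [CommRing R] [Algebra ℂ R] (D : Derivation ℂ R R)
    (f : PowerSeries R) (n : ℕ) : coeff n (coeffDer D f) = D (coeff n f) := by
  change coeff n (PowerSeries.mk fun n => D (coeff n f)) = _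
  rw [PowerSeries.coeff_mk]

theorem coeffDer_expSeries {R : Type*} [CommRing R] [Algebra ℂ R] (D : Derivation ℂ R R)
    {f : PowerSeries R} (hf : coeff 0 f = 0) :
    coeffDer D (expSeries f) = expSeries f * coeffDer D f :=
  derivation_expSeries _ (fun h n hn => by rw [coeff_coeffDer, hn n le_rfl, map_zero]) hf

/-- If `f b - b f = c` is central, then `exp f * b - b * exp f = c * exp f`. -/
theorem expSeries_mul_of_commutator {A : Type*} [Ring A] [Algebra ℂ A] {f b c : PowerSeries A}
    (hf : coeff 0 f = 0) (hc0 : coeff 0 c = 0) (hc : ∀ g, c * g = g * c)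
    (h : f * b = b * f + c) :
    expSeries f * b = b * expSeries f + c * expSeries f := by
  have hk : ∀ k : ℕ, f ^ (k + 1) * b = b * f ^ (k + 1) + (k + 1 : ℕ) • (c * f ^ k) := by
    intro k
    induction k with
    | zero => simpa using h
    | succ k ih =>
      rw [pow_succ' f (k + 1), mul_assoc, ih, mul_add, ← mul_assoc, h, mul_smul_comm, ← mul_assoc f,
        ← hc f, mul_assoc c, ← pow_succ', succ_nsmul _ (k + 1), add_mul, mul_assoc]
      abel
  ext n
  set S : ℕ → PowerSeries A := fun M => ∑ k ∈ Finset.range M, ((k.factorial : ℂ)⁻¹) • f ^ k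
  have hS : ∀ m ≤ n, coeff m (expSeries f) = coeff m (S (n + 1)) := by
    intro m hm
    rw [coeff_expSeries hf (show m < n + 1 by omega), map_sum]
    simp
  have hl : coeff n (expSeries f * b) = coeff n (S (n + 1) * b) := by
    rw [PowerSeries.coeff_mul, PowerSeries.coeff_mul]
    refine Finset.sum_congr rfl fun p hp => ?_
    have := Finset.HasAntidiagonal.mem_antidiagonal.1 hp
    rw [hS _ (by omega)]
  have hr : coeff n (b * expSeries f) = coeff n (b * S (n + 1)) := by
    rw [PowerSeries.coeff_mul, PowerSeries.coeff_mul]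
    refine Finset.sum_congr rfl fun p hp => ?_
    have := Finset.HasAntidiagonal.mem_antidiagonal.1 hp
    rw [hS _ (by omega)]
  have hcr : coeff n (c * expSeries f) = coeff n (c * S n) := by
    rw [PowerSeries.coeff_mul, PowerSeries.coeff_mul]
    refine Finset.sum_congr rfl fun p hp => ?_
    have := Finset.HasAntidiagonal.mem_antidiagonal.1 hp
    by_cases h0 : p.1 = 0
    · rw [h0, hc0, zero_mul, zero_mul]
    · rw [coeff_expSeries hf (show p.2 < n by omega), map_sum]
      simp
  rw [map_add, hl, hr, hcr, ← map_add]
  congr 1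
  simp only [S]
  rw [Finset.sum_range_succ', add_mul, mul_add, Finset.sum_mul, Finset.mul_sum, Finset.mul_sum]
  have : ∀ k ∈ Finset.range n, ((k + 1).factorial : ℂ)⁻¹ • f ^ (k + 1) * b =
      b * (((k + 1).factorial : ℂ)⁻¹ • f ^ (k + 1)) + c * ((k.factorial : ℂ)⁻¹ • f ^ k) := by
    intro k _
    rw [smul_mul_assoc, hk, smul_add, mul_smul_comm, mul_smul_comm, ← Nat.cast_smul_eq_nsmul ℂ,
      smul_smul, factorial_inv_succ_mul]
  rw [Finset.sum_congr rfl this, Finset.sum_add_distrib]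
  simp
  abel

/-- `exp` commutes with algebra maps applied to the coefficients. -/
theorem coeff_expSeries_map {A B : Type*} [Ring A] [Algebra ℂ A] [Ring B] [Algebra ℂ B]
    (φ : A →ₐ[ℂ] B) (f : PowerSeries A) (n : ℕ) :
    coeff n (expSeries (PowerSeries.map (φ : A →+* B) f)) = φ (coeff n (expSeries f)) := by
  rw [expSeries, expSeries, PowerSeries.coeff_mk, PowerSeries.coeff_mk, map_sum]
  refine Finset.sum_congr rfl fun k _ => ?_
  rw [map_smul, ← map_pow, PowerSeries.coeff_map]
  rfl

theorem map_posSeries {A B : Type*} [Ring A] [Ring B] (φ : A →+* B) (a : ℕ+ → A) :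
    PowerSeries.map φ (posSeries a) = posSeries fun n => φ (a n) := by
  ext n
  rw [PowerSeries.coeff_map, posSeries, posSeries, PowerSeries.coeff_mk, PowerSeries.coeff_mk]
  split_ifs
  · rfl
  · exact map_zero φ

/-- Solutions of `u y' = a y` with `a(0) = 0` are determined by their constant terms. -/
theorem eq_of_euler_eq {R : Type*} [CommRing R] [Algebra ℂ R] {a y z : PowerSeries R}
    (ha : coeff 0 a = 0) (hy : euler R y = a * y) (hz : euler R z = a * z)
    (h0 : coeff 0 y = coeff 0 z) : y = z := by
  ext n
  induction n using Nat.strong_induction_on with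
  | _ n ih =>
    rcases Nat.eq_zero_or_pos n with rfl | hn
    · exact h0
    have h1 : (n : R) * coeff n y = n * coeff n z := by
      rw [← coeff_euler, ← coeff_euler, hy, hz, PowerSeries.coeff_mul, PowerSeries.coeff_mul]
      refine Finset.sum_congr rfl fun p hp => ?_
      have hp' := Finset.HasAntidiagonal.mem_antidiagonal.1 hp
      by_cases h : p.1 = 0
      · rw [h, ha, zero_mul, zero_mul]
      · rw [ih p.2 (by omega)]
    have h2 : ((n : ℂ)⁻¹ • (1 : R)) * (n : R) = 1 := by
      rw [smul_mul_assoc, one_mul, show (n : R) = (n : ℂ) • (1 : R) by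
        rw [Nat.cast_smul_eq_nsmul, nsmul_one], smul_smul, inv_mul_cancel₀ (by exact_mod_cast hn.ne'),
        one_smul]
    have := congrArg (fun x => ((n : ℂ)⁻¹ • (1 : R)) * x) h1
    simpa only [← mul_assoc, h2, one_mul] using this

/-! ### The operators on `V₀` and their adjoints -/

/-- `∑_{n ≥ 1} h_{-n} uⁿ`. -/
def psumSeries : PowerSeries V0 := posSeries MvPolynomial.X

/-- `exp (∑_{n ≥ 1} (c / n) h_{-n} uⁿ)`. -/
def gen (c : ℂ) : PowerSeries V0 :=
  expSeries (posSeries fun n => (c / (n : ℕ)) • (MvPolynomial.X n : V0))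

theorem coeff_zero_gen (c : ℂ) : coeff 0 (gen c) = 1 := coeff_zero_expSeries _

theorem posSeries_ext {A : Type*} [Ring A] {f : PowerSeries A} {a : ℕ+ → A} (h0 : coeff 0 f = 0)
    (h : ∀ n : ℕ+, coeff (n : ℕ) f = a n) : f = posSeries a := by
  ext n
  rcases Nat.eq_zero_or_pos n with rfl | hn
  · rw [h0, coeff_zero_posSeries]
  · exact (h ⟨n, hn⟩).trans (coeff_posSeries a ⟨n, hn⟩).symm

theorem euler_gen (c : ℂ) : euler V0 (gen c) = c • psumSeries * gen c := by
  rw [gen, euler_expSeries (coeff_zero_posSeries _), mul_comm]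
  congr 1
  rw [psumSeries]
  ext n : 1
  rw [coeff_euler, PowerSeries.coeff_smul]
  rcases Nat.eq_zero_or_pos n with rfl | hn
  · simp [coeff_zero_posSeries]
  · lift n to ℕ+ using hn
    rw [coeff_posSeries, coeff_posSeries, ← nsmul_eq_mul, ← Nat.cast_smul_eq_nsmul ℂ, smul_smul,
      mul_div_cancel₀]
    exact_mod_cast n.ne_zero

theorem coeffDer_gen (c : ℂ) (D : Derivation ℂ V0 V0) (y : ℕ+ → V0)
    (hD : ∀ n : ℕ+, D (MvPolynomial.X n) = (n : ℕ) • y n) :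
    coeffDer D (gen c) = gen c * c • posSeries y := by
  rw [gen, coeffDer_expSeries _ (coeff_zero_posSeries _)]
  congr 1
  ext n : 1
  rw [coeff_coeffDer, PowerSeries.coeff_smul]
  rcases Nat.eq_zero_or_pos n with rfl | hn
  · simp [coeff_zero_posSeries]
  · lift n to ℕ+ using hn
    rw [coeff_posSeries, coeff_posSeries, Derivation.map_smul, hD, ← Nat.cast_smul_eq_nsmul ℂ,
      smul_smul, div_mul_cancel₀]
    exact_mod_cast n.ne_zero

theorem coeff_expSeries_heisNeg (c : ℂ) (p : ℕ) (f : V0) :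
    coeff p (expSeries (posSeries fun n : ℕ+ => (c / (n : ℕ)) • heisNeg n)) f =
      coeff p (gen c) * f := by
  have h := coeff_expSeries_map (Algebra.lmul ℂ V0)
    (posSeries fun n : ℕ+ => (c / (n : ℕ)) • (MvPolynomial.X n : V0)) p
  rw [map_posSeries] at h
  have h2 : (fun n : ℕ+ => (c / (n : ℕ)) • heisNeg n) = fun n : ℕ+ =>
      (Algebra.lmul ℂ V0 : V0 →+* Module.End ℂ V0) ((c / (n : ℕ)) • (MvPolynomial.X n : V0)) := by
    funext n
    exact (map_smul (Algebra.lmul ℂ V0) _ _).symm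
  rw [h2, h]
  rfl

/-- The translation `p_n ↦ p_n + xⁿ`. -/
def transl : V0 →ₐ[ℂ] PowerSeries V0 :=
  MvPolynomial.aeval fun n : ℕ+ => PowerSeries.C (MvPolynomial.X n) + PowerSeries.X ^ (n : ℕ)

theorem coeff_transl_one (p : ℕ) : coeff p (transl 1) = if p = 0 then 1 else 0 := by
  rw [map_one, PowerSeries.coeff_one]

theorem coeff_transl_X_mul (p : ℕ) (n : ℕ+) (f : V0) :
    coeff p (transl (MvPolynomial.X n * f)) = MvPolynomial.X n * coeff p (transl f) +
      if (n : ℕ) ≤ p then coeff (p - n) (transl f) else 0 := by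
  rw [map_mul, transl, MvPolynomial.aeval_X, add_mul, map_add, PowerSeries.coeff_C_mul,
    PowerSeries.coeff_X_pow_mul']

/-- Induction on polynomials by multiplication with variables. -/
theorem V0.induction {P : V0 → Prop} (one : P 1) (add : ∀ f g, P f → P g → P (f + g))
    (smul : ∀ (c : ℂ) f, P f → P (c • f)) (mul : ∀ (n : ℕ+) f, P f → P (MvPolynomial.X n * f))
    (f : V0) : P f := by
  induction f using MvPolynomial.induction_on with
  | C a =>
    have := smul a 1 one
    rwa [MvPolynomial.smul_eq_C_mul, mul_one] at this
  | add p q hp hq => exact add p q hp hq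
  | mul_X p n hp => rw [mul_comm]; exact mul n p hp

theorem coeff_expSeries_heisPos {α : ℕ} (hα : 0 < α) (p : ℕ) (f : V0) :
    coeff p (expSeries (posSeries fun n : ℕ+ => ((α : ℂ) / (n : ℕ)) • heisPos α n)) f =
      coeff p (transl f) := by
  set a : ℕ+ → Module.End ℂ V0 := fun n => ((α : ℂ) / (n : ℕ)) • heisPos α n with ha
  have ha' : ∀ n f, a n f = MvPolynomial.pderiv n f := by
    intro n f
    simp only [ha, heisPos, LinearMap.smul_apply, smul_smul]
    have h1 : (α : ℂ) ≠ 0 := by exact_mod_cast hα.ne'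
    have h2 : ((n : ℕ) : ℂ) ≠ 0 := by exact_mod_cast n.ne_zero
    rw [show (α : ℂ) / (n : ℕ) * ((α : ℂ)⁻¹ * (n : ℕ)) = 1 by field_simp, one_smul]
    rfl
  have hone : ∀ n, a n 1 = 0 := fun n => by rw [ha', Derivation.map_one_eq_zero]
  induction f using V0.induction generalizing p with
  | one =>
    rw [coeff_transl_one]
    rcases Nat.eq_zero_or_pos p with rfl | hp
    · rw [coeff_zero_expSeries]; simp
    · rw [if_neg hp.ne', expSeries, PowerSeries.coeff_mk, LinearMap.sum_apply]
      refine Finset.sum_eq_zero fun k _ => ?_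
      rw [LinearMap.smul_apply]
      cases k with
      | zero => simp [PowerSeries.coeff_one, hp.ne']
      | succ k =>
        rw [pow_succ, PowerSeries.coeff_mul, LinearMap.sum_apply, Finset.sum_eq_zero, smul_zero]
        intro q _
        rw [Module.End.mul_apply]
        rcases Nat.eq_zero_or_pos q.2 with h | h
        · rw [h, coeff_zero_posSeries]; simp
        · obtain ⟨m, hm⟩ : ∃ m : ℕ+, (m : ℕ) = q.2 := ⟨⟨_, h⟩, rfl⟩
          rw [← hm, coeff_posSeries, hone, map_zero]
  | add f g hf hg => rw [map_add, map_add, map_add, hf, hg]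
  | smul c f hf => rw [map_smul, map_smul, PowerSeries.coeff_smul, hf]
  | mul n f hf =>
    have key := expSeries_mul_of_commutator (f := posSeries a)
      (b := PowerSeries.C (LinearMap.mulLeft ℂ (MvPolynomial.X n : V0)))
      (c := PowerSeries.X ^ (n : ℕ)) (coeff_zero_posSeries a)
      (by rw [PowerSeries.coeff_X_pow, if_neg n.ne_zero.symm])
      (fun g => PowerSeries.commute_X_pow g n |>.symm.eq) (by
        ext m : 1
        rw [map_add, PowerSeries.coeff_mul_C, PowerSeries.coeff_C_mul, PowerSeries.coeff_X_pow]
        rcases Nat.eq_zero_or_pos m with rfl | hm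
        · rw [coeff_zero_posSeries, if_neg n.ne_zero.symm]; simp
        · lift m to ℕ+ using hm
          rw [coeff_posSeries]
          refine LinearMap.ext fun f => ?_
          rw [Module.End.mul_apply, LinearMap.mulLeft_apply, ha', Derivation.leibniz,
            LinearMap.add_apply, Module.End.mul_apply, LinearMap.mulLeft_apply, ha',
            MvPolynomial.pderiv_X, smul_eq_mul, smul_eq_mul]
          by_cases h : m = n
          · subst h; simp
          · rw [Pi.single_eq_of_ne (Ne.symm h), if_neg (fun h' => h (PNat.coe_injective h'))]; simp)
    have := LinearMap.congr_fun (congrArg (coeff p) key) f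
    rw [map_add, PowerSeries.coeff_mul_C, PowerSeries.coeff_C_mul, PowerSeries.coeff_X_pow_mul',
      Module.End.mul_apply, LinearMap.add_apply, Module.End.mul_apply, LinearMap.mulLeft_apply,
      LinearMap.mulLeft_apply, hf] at this
    rw [this, coeff_transl_X_mul]
    congr 1
    split_ifs
    · exact hf _
    · rfl

/-- The scalar product transported to `V₀`. -/
def pair (α : ℕ) : LinearMap.BilinForm ℂ V0 :=
  (scal α).compl₁₂ toLam.toLinearMap toLam.toLinearMap

theorem pair_apply (α : ℕ) (f g : V0) : pair α f g = scal α (toLam f) (toLam g) := rfl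

theorem pair_monomial (α : ℕ) (l m : Par) :
    pair α (MvPolynomial.monomial l 1) (MvPolynomial.monomial m 1) =
      if l = m then (zee l : ℂ) * ((α : ℂ) ^ len l)⁻¹ else 0 := by
  rw [pair_apply, toLam_monomial, toLam_monomial, one_smul, one_smul, scal_psumPar]

theorem zee_add_single (l : Par) (n : ℕ+) :
    zee (l + Finsupp.single n 1) = zee l * (n * (l n + 1)) := by
  classical
  have h1 : zee (l + Finsupp.single n 1) = ∏ i ∈ insert n l.support,
      (i : ℕ) ^ ((l + Finsupp.single n 1 : Par) i) * ((l + Finsupp.single n 1 : Par) i).factorial :=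
    Finsupp.prod_of_support_subset _ (by
      intro i hi
      by_contra h
      simp only [Finset.mem_insert, Finsupp.mem_support_iff, not_or, not_not] at h
      simp [h.2, Ne.symm h.1] at hi) _ (by simp)
  have h2 : zee l = ∏ i ∈ insert n l.support, (i : ℕ) ^ (l i) * (l i).factorial :=
    Finsupp.prod_of_support_subset _ (Finset.subset_insert _ _) _ (by simp)
  have hn : n ∈ insert n l.support := Finset.mem_insert_self _ _
  rw [h1, h2, ← Finset.mul_prod_erase _ _ hn, ← Finset.mul_prod_erase _ _ hn]
  have : ∀ i ∈ (insert n l.support).erase n, (i : ℕ) ^ ((l + Finsupp.single n 1 : Par) i) *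
      ((l + Finsupp.single n 1 : Par) i).factorial = (i : ℕ) ^ (l i) * (l i).factorial := by
    intro i hi
    have : n ≠ i := (Finset.ne_of_mem_erase hi).symm
    simp [this]
  rw [Finset.prod_congr rfl this]
  simp only [Finsupp.coe_add, Pi.add_apply, Finsupp.single_eq_same, Nat.factorial_succ]
  ring

theorem bilin_ext {B B' : LinearMap.BilinForm ℂ V0} (h : ∀ l m : Par,
    B (MvPolynomial.monomial l 1) (MvPolynomial.monomial m 1) =
      B' (MvPolynomial.monomial l 1) (MvPolynomial.monomial m 1)) : B = B' :=
  (MvPolynomial.basisMonomials ℕ+ ℂ).ext fun l =>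
    (MvPolynomial.basisMonomials ℕ+ ℂ).ext fun m => by
      simpa only [MvPolynomial.coe_basisMonomials] using h l m

theorem pair_heisNeg {α : ℕ} (n : ℕ+) (f g : V0) :
    pair α (heisNeg n f) g = pair α f (heisPos α n g) := by
  suffices (pair α).compl₁₂ (heisNeg n) LinearMap.id =
      (pair α).compl₁₂ LinearMap.id (heisPos α n) from LinearMap.congr_fun₂ this f g
  refine bilin_ext fun l m => ?_
  have hX : heisNeg n (MvPolynomial.monomial l 1 : V0) =
      MvPolynomial.monomial (l + Finsupp.single n 1) 1 := by
    rw [heisNeg, LinearMap.mulLeft_apply, MvPolynomial.X, MvPolynomial.monomial_mul, one_mul,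
      add_comm]
  have hP : heisPos α n (MvPolynomial.monomial m 1 : V0) =
      ((α : ℂ)⁻¹ * (n : ℕ) * (m n : ℂ)) •
        MvPolynomial.monomial (m - Finsupp.single n 1) 1 := by
    change ((α : ℂ)⁻¹ * (n : ℕ)) • MvPolynomial.pderiv n (MvPolynomial.monomial m 1) = _
    rw [MvPolynomial.pderiv_monomial, one_mul, MvPolynomial.smul_monomial,
      MvPolynomial.smul_monomial, smul_eq_mul, smul_eq_mul, mul_one]
  rw [LinearMap.compl₁₂_apply, LinearMap.compl₁₂_apply, hX, hP, LinearMap.id_apply,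
    LinearMap.id_apply, map_smul, pair_monomial, pair_monomial]
  by_cases h : l + Finsupp.single n 1 = m
  · subst h
    rw [if_pos rfl, add_tsub_cancel_right, if_pos rfl, zee_add_single, len_add, ← part_pos,
      len_part n.ne_zero]
    simp only [Finsupp.coe_add, Pi.add_apply, part_pos, Finsupp.single_eq_same, smul_eq_mul,
      pow_succ, mul_inv]
    push_cast
    ring
  · rw [if_neg h]
    by_cases hm : m n = 0
    · rw [hm, Nat.cast_zero, mul_zero, zero_smul]
    · rw [if_neg, smul_zero]
      rintro rfl
      exact h (tsub_add_cancel_of_le (Finsupp.single_le_iff.2 (Nat.one_le_iff_ne_zero.2 hm)))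

theorem pair_symm (α : ℕ) (f g : V0) : pair α f g = pair α g f := by
  suffices pair α = (pair α).flip from LinearMap.congr_fun₂ this f g
  refine bilin_ext fun l m => ?_
  change _ = pair α (MvPolynomial.monomial m 1) (MvPolynomial.monomial l 1)
  rw [pair_monomial, pair_monomial]
  by_cases h : l = m
  · subst h; rfl
  · rw [if_neg h, if_neg (Ne.symm h)]

/-- Adjoints of exponentials are exponentials of adjoints. -/
theorem adjoint_expSeries (B : LinearMap.BilinForm ℂ V0) {a b : ℕ+ → Module.End ℂ V0}
    (h : ∀ n f g, B (a n f) g = B f (b n g)) (p : ℕ) (f g : V0) :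
    B (coeff p (expSeries (posSeries a)) f) g = B f (coeff p (expSeries (posSeries b)) g) := by
  have h1 : ∀ n f g, B (coeff n (posSeries a) f) g = B f (coeff n (posSeries b) g) := by
    intro n f g
    rcases Nat.eq_zero_or_pos n with rfl | hn
    · simp [coeff_zero_posSeries]
    · lift n to ℕ+ using hn
      rw [coeff_posSeries, coeff_posSeries, h]
  have hk : ∀ (k n : ℕ) (f g : V0), B (coeff n (posSeries a ^ k) f) g = B f (coeff n (posSeries b ^ k) g) := by
    intro k
    induction k with
    | zero =>
      intro n f g
      rw [pow_zero, pow_zero, PowerSeries.coeff_one]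
      split_ifs <;> simp
    | succ k ih =>
      intro n f g
      rw [pow_succ, pow_succ', PowerSeries.coeff_mul, PowerSeries.coeff_mul, LinearMap.sum_apply,
        LinearMap.sum_apply, map_sum, LinearMap.sum_apply, map_sum]
      refine Finset.sum_equiv (Equiv.prodComm ℕ ℕ) (by simp [add_comm]) fun q _ => ?_
      rw [Module.End.mul_apply, Module.End.mul_apply, ih, h1]
      rfl
  rw [expSeries, expSeries, PowerSeries.coeff_mk, PowerSeries.coeff_mk, LinearMap.sum_apply,
    LinearMap.sum_apply, map_sum, LinearMap.sum_apply, map_sum]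
  refine Finset.sum_congr rfl fun k _ => ?_
  rw [LinearMap.smul_apply, LinearMap.smul_apply, map_smul, LinearMap.smul_apply, map_smul, hk]

theorem pair_gen_mul {α : ℕ} (hα : 0 < α) (p : ℕ) (f g : V0) :
    pair α (coeff p (gen α) * f) g = pair α f (coeff p (transl g)) := by
  rw [← coeff_expSeries_heisNeg, ← coeff_expSeries_heisPos hα]
  refine adjoint_expSeries _ (fun n f g => ?_) p f g
  rw [LinearMap.smul_apply, LinearMap.smul_apply, map_smul, LinearMap.smul_apply, map_smul,
    pair_heisNeg]

theorem pair_creation {α : ℕ} (hα : 0 < α) (p : ℕ) (f g : V0) :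
    pair α (coeff p (creation α) f) g = pair α f (coeff p (transl g)) := by
  rw [creation, coeff_expSeries_heisNeg, pair_gen_mul hα]

theorem pair_annihilation (α p : ℕ) (f g : V0) :
    pair α (coeff p (annihilation α) f) g = pair α f (coeff p (gen (-(2 * α))) * g) := by
  rw [← coeff_expSeries_heisNeg]
  refine adjoint_expSeries _ (fun n f g => ?_) p f g
  rw [LinearMap.smul_apply, LinearMap.smul_apply, map_smul, LinearMap.smul_apply, map_smul,
    pair_symm, ← pair_heisNeg, pair_symm]

/-! ### Finitely many variables -/

/-- Evaluation of `p_n` at `∑_a z_aⁿ` in `N` variables `z_a`. -/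
def evalN (N : ℕ) : V0 →ₐ[ℂ] MvPolynomial (Fin N) ℂ :=
  MvPolynomial.aeval fun n : ℕ+ => ∑ a, MvPolynomial.X a ^ (n : ℕ)

theorem evalN_X (N : ℕ) (n : ℕ+) :
    evalN N (MvPolynomial.X n) = ∑ a, MvPolynomial.X a ^ (n : ℕ) := by
  rw [evalN, MvPolynomial.aeval_X]

/-- `∏_{a < b} (z_a - z_b)`. -/
def vdm (N : ℕ) : MvPolynomial (Fin N) ℂ :=
  ∏ a, ∏ b ∈ Finset.Ioi a, (MvPolynomial.X a - MvPolynomial.X b)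

/-- `∏_b (x - z_b)`. -/
def linProd (N : ℕ) : Polynomial (MvPolynomial (Fin N) ℂ) :=
  ∏ b, (Polynomial.X - Polynomial.C (MvPolynomial.X b))

theorem finSuccEquiv_vdm (N : ℕ) :
    MvPolynomial.finSuccEquiv ℂ N (vdm (N + 1)) = linProd N * Polynomial.C (vdm N) := by
  rw [vdm, Fin.prod_univ_succ, map_mul, Fin.prod_Ioi_zero, map_prod, map_prod, linProd, vdm,
    map_prod]
  congr 1
  · refine Finset.prod_congr rfl fun b _ => ?_
    rw [map_sub, MvPolynomial.finSuccEquiv_X_zero, MvPolynomial.finSuccEquiv_X_succ]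
  · refine Finset.prod_congr rfl fun b _ => ?_
    rw [Fin.prod_Ioi_succ, map_prod, map_prod]
    refine Finset.prod_congr rfl fun c _ => ?_
    rw [map_sub, MvPolynomial.finSuccEquiv_X_succ, MvPolynomial.finSuccEquiv_X_succ, map_sub]

theorem finSuccEquiv_evalN (N : ℕ) (f : V0) :
    ((MvPolynomial.finSuccEquiv ℂ N (evalN (N + 1) f) : Polynomial _) : PowerSeries _) =
      PowerSeries.map (evalN N : V0 →+* MvPolynomial (Fin N) ℂ) (transl f) := by
  induction f using V0.induction with
  | one => simp
  | add f g hf hg => rw [map_add, map_add, Polynomial.coe_add, hf, hg, map_add, map_add]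
  | smul c f hf =>
    ext n : 1
    have := congrArg (coeff n) hf
    rw [Polynomial.coeff_coe, PowerSeries.coeff_map] at this ⊢
    rw [map_smul, map_smul, map_smul, Polynomial.coeff_smul, PowerSeries.coeff_smul, this]
    exact (map_smul (evalN N) _ _).symm
  | mul n f hf =>
    have h1 : MvPolynomial.finSuccEquiv ℂ N (evalN (N + 1) (MvPolynomial.X n)) =
        Polynomial.X ^ (n : ℕ) + Polynomial.C (evalN N (MvPolynomial.X n)) := by
      rw [evalN_X, evalN_X, Fin.sum_univ_succ, map_add, map_pow, MvPolynomial.finSuccEquiv_X_zero,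
        map_sum, map_sum]
      congr 1
      refine Finset.sum_congr rfl fun a _ => ?_
      rw [map_pow, map_pow, MvPolynomial.finSuccEquiv_X_succ]
    have h2 : transl (MvPolynomial.X n) =
        PowerSeries.C (MvPolynomial.X n) + PowerSeries.X ^ (n : ℕ) := by
      rw [transl, MvPolynomial.aeval_X]
    have h3 : ((Polynomial.X ^ (n : ℕ) + Polynomial.C (evalN N (MvPolynomial.X n)) :
        Polynomial (MvPolynomial (Fin N) ℂ)) : PowerSeries (MvPolynomial (Fin N) ℂ)) =
        PowerSeries.map (evalN N : V0 →+* MvPolynomial (Fin N) ℂ) (transl (MvPolynomial.X n)) := by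
      rw [h2, Polynomial.coe_add, Polynomial.coe_pow, Polynomial.coe_X, Polynomial.coe_C,
        RingHom.map_add, RingHom.map_pow, PowerSeries.map_X, PowerSeries.map_C, add_comm,
        RingHom.coe_coe]
    rw [map_mul (evalN (N + 1)), map_mul (MvPolynomial.finSuccEquiv ℂ N), Polynomial.coe_mul, hf,
      map_mul transl, RingHom.map_mul, h1, h3]

theorem coeff_finSuccEquiv_evalN (N p : ℕ) (f : V0) :
    (MvPolynomial.finSuccEquiv ℂ N (evalN (N + 1) f)).coeff p =
      evalN N (coeff p (transl f)) := by
  have := congrArg (coeff p) (finSuccEquiv_evalN N f)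
  rwa [Polynomial.coeff_coe, PowerSeries.coeff_map] at this

theorem derivation_prod_of_log {R M ι : Type*} [CommRing R] [CommRing M] [Algebra R M]
    (D : Derivation R M M) (s : Finset ι) (w η : ι → M) (h : ∀ i ∈ s, D (w i) = η i * w i) :
    D (∏ i ∈ s, w i) = (∑ i ∈ s, η i) * ∏ i ∈ s, w i := by
  classical
  induction s using Finset.induction_on with
  | empty => simp
  | insert i s hi ih =>
    rw [Finset.prod_insert hi, Finset.sum_insert hi, Derivation.leibniz, h i (by simp),
      ih fun j hj => h j (by simp [hj]), smul_eq_mul, smul_eq_mul]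
    ring

theorem derivation_pow_of_log {R M : Type*} [CommRing R] [CommRing M] [Algebra R M]
    (D : Derivation R M M) {w η : M} (h : D w = η * w) (k : ℕ) :
    D (w ^ k) = (k * η) * w ^ k := by
  cases k with
  | zero => simp
  | succ k =>
    rw [Derivation.leibniz_pow, h, add_tsub_cancel_right, smul_eq_mul, nsmul_eq_mul, pow_succ]
    ring

theorem euler_map {R S : Type*} [CommRing R] [Algebra ℂ R] [CommRing S] [Algebra ℂ S]
    (φ : R →+* S) (f : PowerSeries R) :
    euler S (PowerSeries.map φ f) = PowerSeries.map φ (euler R f) := by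
  ext n
  rw [coeff_euler, PowerSeries.coeff_map, PowerSeries.coeff_map, coeff_euler, map_mul, map_natCast]

theorem posSeries_pow_mul {R : Type*} [CommRing R] (z : R) :
    (posSeries fun n : ℕ+ => z ^ (n : ℕ)) * (1 - PowerSeries.X * PowerSeries.C z) =
      PowerSeries.X * PowerSeries.C z := by
  ext n
  rw [mul_sub, mul_one, ← mul_assoc, map_sub, PowerSeries.coeff_mul_C, PowerSeries.coeff_mul_C]
  cases n with
  | zero => simp [coeff_zero_posSeries]
  | succ n =>
    have h : ∀ m : ℕ, 0 < m → coeff m (posSeries fun n : ℕ+ => z ^ (n : ℕ)) = z ^ m := by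
      intro m hm
      lift m to ℕ+ using hm
      rw [coeff_posSeries]
    rw [h _ n.succ_pos, PowerSeries.coeff_succ_mul_X, PowerSeries.coeff_X]
    rcases Nat.eq_zero_or_pos n with rfl | hn
    · simp [coeff_zero_posSeries]
    · rw [h _ hn, if_neg (by omega), Nat.succ_eq_add_one, pow_succ]; ring

theorem map_gen_eq (N α : ℕ) : PowerSeries.map (evalN N : V0 →+* MvPolynomial (Fin N) ℂ) (gen (-(2 * α))) =
    (∏ b, (1 - PowerSeries.X * PowerSeries.C (MvPolynomial.X b : MvPolynomial (Fin N) ℂ))) ^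
      (2 * α) := by
  set s : Fin N → PowerSeries (MvPolynomial (Fin N) ℂ) := fun b =>
    posSeries fun n : ℕ+ => (MvPolynomial.X b : MvPolynomial (Fin N) ℂ) ^ (n : ℕ)
  refine eq_of_euler_eq (a := ((2 * α : ℕ) : PowerSeries (MvPolynomial (Fin N) ℂ)) * ∑ b, -s b)
    ?_ ?_ ?_ ?_
  · simp only [PowerSeries.coeff_zero_eq_constantCoeff, map_mul, map_sum, map_neg]
    simp only [← PowerSeries.coeff_zero_eq_constantCoeff_apply, s, coeff_zero_posSeries]
    simp
  · rw [euler_map, euler_gen, map_mul]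
    congr 1
    rw [Finset.sum_neg_distrib, mul_neg, neg_smul, map_neg]
    congr 1
    have h1 : PowerSeries.map (evalN N : V0 →+* MvPolynomial (Fin N) ℂ) psumSeries = ∑ b, s b := by
      rw [psumSeries, map_posSeries]
      refine (posSeries_ext ?_ fun n => ?_).symm
      · rw [map_sum]
        exact Finset.sum_eq_zero fun b _ => coeff_zero_posSeries _
      · rw [map_sum, RingHom.coe_coe, evalN_X]
        exact Finset.sum_congr rfl fun b _ => coeff_posSeries _ _
    rw [← h1, show (2 * (α : ℂ)) = ((2 * α : ℕ) : ℂ) by push_cast; rfl, Nat.cast_smul_eq_nsmul,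
      nsmul_eq_mul, map_mul, map_natCast]
  · refine derivation_pow_of_log _ (derivation_prod_of_log _ _ _ _ fun b _ => ?_) _
    rw [neg_mul, posSeries_pow_mul, map_sub, Derivation.map_one_eq_zero, zero_sub]
    congr 1
    ext n : 1
    rw [coeff_euler, PowerSeries.coeff_mul_C, PowerSeries.coeff_X]
    split_ifs with h
    · subst h; simp
    · simp
  · rw [PowerSeries.coeff_map, coeff_zero_gen, map_one]
    simp [PowerSeries.coeff_zero_eq_constantCoeff]

theorem linProd_monic (N : ℕ) : (linProd N).Monic :=
  Polynomial.monic_prod_of_monic _ _ fun _ _ => Polynomial.monic_X_sub_C _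

theorem natDegree_linProd (N : ℕ) : (linProd N).natDegree = N := by
  rw [linProd, Polynomial.natDegree_prod_of_monic _ _ fun _ _ => Polynomial.monic_X_sub_C _]
  simp

theorem reverse_X_sub_C {R : Type*} [CommRing R] [Nontrivial R] (z : R) :
    (Polynomial.X - Polynomial.C z).reverse = 1 - Polynomial.X * Polynomial.C z := by
  ext n
  rw [Polynomial.coeff_reverse, Polynomial.natDegree_X_sub_C]
  rcases n with _ | _ | n
  · rw [Polynomial.revAt_le (by omega)]
    simp
  · rw [Polynomial.revAt_le (by omega)]
    simp [Polynomial.coeff_one]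
  · rw [Polynomial.revAt_eq_self_of_lt (by omega)]
    simp [Polynomial.coeff_X, Polynomial.coeff_one]

theorem reverse_linProd_pow (N k : ℕ) : (linProd N ^ k).reverse =
    (∏ b, (1 - Polynomial.X * Polynomial.C (MvPolynomial.X b : MvPolynomial (Fin N) ℂ))) ^ k := by
  have h1 : ∀ s : Finset (Fin N),
      (∏ b ∈ s, (Polynomial.X - Polynomial.C (MvPolynomial.X b : MvPolynomial (Fin N) ℂ))).reverse =
      ∏ b ∈ s, (1 - Polynomial.X * Polynomial.C (MvPolynomial.X b)) := by
    intro s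
    induction s using Finset.induction_on with
    | empty => simpa using Polynomial.reverse_C (1 : MvPolynomial (Fin N) ℂ)
    | insert b s hb ih =>
      rw [Finset.prod_insert hb, Finset.prod_insert hb, Polynomial.reverse_mul_of_domain, ih,
        reverse_X_sub_C]
  induction k with
  | zero => simpa using Polynomial.reverse_C (1 : MvPolynomial (Fin N) ℂ)
  | succ k ih =>
    rw [pow_succ, pow_succ, Polynomial.reverse_mul_of_domain, ih, linProd, h1]

theorem evalN_coeff_gen (N α q : ℕ) : evalN N (coeff q (gen (-(2 * α)))) =
    if q ≤ 2 * α * N then (linProd N ^ (2 * α)).coeff (2 * α * N - q) else 0 := by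
  have h1 : evalN N (coeff q (gen (-(2 * α)))) = (linProd N ^ (2 * α)).reverse.coeff q := by
    have := congrArg (coeff q) (map_gen_eq N α)
    rw [PowerSeries.coeff_map] at this
    refine this.trans ?_
    rw [reverse_linProd_pow, ← Polynomial.coeff_coe, Polynomial.coe_pow]
    congr 2
    rw [← Polynomial.coeToPowerSeries.ringHom_apply, map_prod]
    refine Finset.prod_congr rfl fun b _ => ?_
    rw [Polynomial.coeToPowerSeries.ringHom_apply, Polynomial.coe_sub, Polynomial.coe_mul,
      Polynomial.coe_one, Polynomial.coe_X, Polynomial.coe_C]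
  have hd : (linProd N ^ (2 * α)).natDegree = 2 * α * N := by
    rw [(linProd_monic N).natDegree_pow, natDegree_linProd]
  rw [h1, Polynomial.coeff_reverse, hd]
  split_ifs with h
  · rw [Polynomial.revAt_le h]
  · rw [Polynomial.revAt_eq_self_of_lt (by omega)]
    exact Polynomial.coeff_eq_zero_of_natDegree_lt (by omega)

/-! ### Matrix coefficients of products of vertex operators -/

theorem finsum_eq_antidiagonal (κ M : ℕ) (h : ℕ × ℕ → ℂ) (hh : ∀ p, M < p.2 → h p = 0) :
    ∑ᶠ p : {p : ℕ × ℕ // (p.1 : ℤ) - p.2 = (κ : ℤ) - M}, h p.1 =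
      ∑ p ∈ Finset.HasAntidiagonal.antidiagonal κ, if p.1 ≤ M then h (p.2, M - p.1) else 0 := by
  classical
  rw [finsum_subtype_eq_finsum_cond (f := h) fun p : ℕ × ℕ => (p.1 : ℤ) - p.2 = (κ : ℤ) - M,
    ← Finset.sum_filter]
  have hi : Set.InjOn (fun p : ℕ × ℕ => (p.2, M - p.1))
      ((Finset.HasAntidiagonal.antidiagonal κ).filter fun p => p.1 ≤ M) := by
    rintro ⟨a, b⟩ h1 ⟨c, d⟩ h2 h3
    simp only [Finset.coe_filter, Finset.HasAntidiagonal.mem_antidiagonal, Set.mem_ofPred_eq,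
      Prod.mk.injEq] at h1 h2 h3 ⊢
    omega
  rw [← Finset.sum_image (f := h) hi]
  refine finsum_mem_eq_sum_of_inter_support_eq (s := {p | (p.1 : ℤ) - p.2 = (κ : ℤ) - M}) h ?_
  ext ⟨a, b⟩
  simp only [Set.mem_inter_iff, Set.mem_ofPred_eq, Finset.coe_image, Set.mem_image,
    Finset.coe_filter, Finset.HasAntidiagonal.mem_antidiagonal, and_congr_left_iff, Prod.mk.injEq,
    Prod.exists]
  intro hs
  have hb : b ≤ M := by
    by_contra hb
    exact hs (hh _ (by simpa using hb))
  constructor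
  · intro h1
    exact ⟨M - b, a, by omega, by omega, by omega⟩
  · rintro ⟨c, d, h1, h2, h3⟩
    omega

theorem pair_normalCoeff {α : ℕ} (hα : 0 < α) (c : ℤ) (F f : V0) :
    pair α (normalCoeff α c F) f = ∑ᶠ p : {p : ℕ × ℕ // (p.1 : ℤ) - p.2 = c},
      pair α F (coeff p.1.2 (gen (-(2 * α))) * coeff p.1.1 (transl f)) := by
  change (pair α).flip f (∑ᶠ p : {p : ℕ × ℕ // (p.1 : ℤ) - p.2 = c}, coeff p.1.1 (creation α)
    (coeff p.1.2 (annihilation α) F)) = _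
  have := ((pair α).flip f).toAddMonoidHom.map_finsum (finite_support α c F)
  refine this.trans (finsum_congr fun p => ?_)
  change pair α (coeff p.1.1 (creation α) (coeff p.1.2 (annihilation α) F)) f = _
  rw [pair_creation hα, pair_annihilation]

theorem X_single (α : ℕ) (n j : ℤ) (f : V0) :
    X α n (Finsupp.single j f) = Finsupp.single (j + 2) (normalCoeff α (-n - (j + 1) * α) f) := by
  simp [X]

theorem pair_one_left (α : ℕ) (f : V0) : pair α 1 f = MvPolynomial.coeff 0 (evalN 0 f) := by
  induction f using V0.induction with
  | one =>
    have := pair_monomial α 0 0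
    rw [if_pos rfl] at this
    rw [map_one (evalN 0), MvPolynomial.coeff_zero_one]
    simpa [zee, len] using this
  | add f g hf hg => rw [map_add, map_add, MvPolynomial.coeff_add, hf, hg]
  | smul c f hf => rw [map_smul, map_smul, MvPolynomial.coeff_smul, hf]
  | mul n f hf =>
    rw [map_mul (evalN 0), evalN_X, Finset.univ_eq_empty, Finset.sum_empty, zero_mul, MvPolynomial.coeff_zero,
      pair_symm]
    change pair α (heisNeg n f) 1 = 0
    rw [pair_heisNeg]
    have : heisPos α n 1 = 0 := by simp [heisPos]
    rw [this, map_zero]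

/-- The matrix coefficients of a product of vertex operators as coefficients of an even power of
the Vandermonde determinant times a symmetric polynomial. -/
theorem exists_XProd_eq {α : ℕ} (hα : 0 < α) (j : ℤ) : ∀ (N : ℕ) (κ : Fin N →₀ ℕ), ∃ F : V0,
    XProd α (List.ofFn fun a => (κ a : ℤ) + (j + 1) * α) (expVec j) =
      Finsupp.single (j + 2 * N) F ∧
    ∀ f, pair α F f = MvPolynomial.coeff κ (vdm N ^ (2 * α) * evalN N f) := by
  intro N
  induction N with
  | zero =>
    intro κ
    refine ⟨1, by simp [XProd, expVec], fun f => ?_⟩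
    rw [pair_one_left, Subsingleton.elim κ 0]
    simp [vdm]
  | succ N ih =>
    intro κ
    obtain ⟨F, hF, hp⟩ := ih κ.tail
    refine ⟨normalCoeff α ((κ 0 : ℤ) - (2 * α * N : ℕ)) F, ?_, fun f => ?_⟩
    · rw [List.ofFn_succ, XProd, List.map_cons, List.prod_cons, Module.End.mul_apply]
      have : (fun a : Fin N => ((κ a.succ : ℕ) : ℤ) + (j + 1) * α) =
          fun a => ((κ.tail a : ℕ) : ℤ) + (j + 1) * α := rfl
      rw [this]
      change X α _ (XProd α _ (expVec j)) = _
      rw [hF, X_single, show -(-((κ 0 : ℤ) + (j + 1) * α)) - (j + 2 * N + 1) * α =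
        (κ 0 : ℤ) - (2 * α * N : ℕ) by push_cast; ring,
        show j + 2 * (N : ℤ) + 2 = j + 2 * (N + 1 : ℕ) by push_cast; ring]
    · rw [pair_normalCoeff hα]
      simp only [hp]
      rw [finsum_eq_antidiagonal (κ 0) (2 * α * N) (fun p => MvPolynomial.coeff κ.tail
        (vdm N ^ (2 * α) * evalN N (coeff p.2 (gen (-(2 * α))) * coeff p.1 (transl f))))]
      · conv_rhs => rw [← Finsupp.cons_tail κ, ← MvPolynomial.finSuccEquiv_coeff_coeff, map_mul,
          map_pow, finSuccEquiv_vdm, mul_pow, ← map_pow, mul_assoc, Polynomial.coeff_mul,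
          MvPolynomial.coeff_sum]
        refine Finset.sum_congr rfl fun p _ => ?_
        rw [Polynomial.coeff_C_mul, coeff_finSuccEquiv_evalN]
        split_ifs with h
        · rw [map_mul, evalN_coeff_gen, if_pos (Nat.sub_le _ _), Nat.sub_sub_self h]
          congr 1
          ring
        · rw [Polynomial.coeff_eq_zero_of_natDegree_lt, zero_mul, MvPolynomial.coeff_zero]
          rw [(linProd_monic N).natDegree_pow, natDegree_linProd]
          omega
      · intro p hp
        rw [map_mul, evalN_coeff_gen, if_neg (by omega), zero_mul, mul_zero,
          MvPolynomial.coeff_zero]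

/-! ### Virasoro constraints -/

/-- The constant exponent `(c, …, c)`. -/
def constExp (N c : ℕ) : Fin N →₀ ℕ := Finsupp.equivFunOnFinite.symm fun _ => c

theorem constExp_apply (N c : ℕ) (a : Fin N) : constExp N c a = c := rfl

/-- The derivation `∑_a z_a^{n+1} ∂/∂z_a`. -/
def witt (N n : ℕ) : Derivation ℂ (MvPolynomial (Fin N) ℂ) (MvPolynomial (Fin N) ℂ) :=
  ∑ a, (MvPolynomial.X a ^ (n + 1) : MvPolynomial (Fin N) ℂ) • MvPolynomial.pderiv a

theorem witt_apply (N n : ℕ) (h : MvPolynomial (Fin N) ℂ) :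
    witt N n h = ∑ a, MvPolynomial.X a ^ (n + 1) * MvPolynomial.pderiv a h := by
  rw [witt, ← Derivation.coeFnAddMonoidHom_apply, map_sum, Finset.sum_apply]
  rfl

theorem witt_X (N n : ℕ) (b : Fin N) :
    witt N n (MvPolynomial.X b) = MvPolynomial.X b ^ (n + 1) := by
  rw [witt_apply, Finset.sum_eq_single b]
  · rw [MvPolynomial.pderiv_X_self, mul_one]
  · intro a _ h
    rw [MvPolynomial.pderiv_X_of_ne h.symm, mul_zero]
  · simp

theorem coeff_X_mul_pderiv {N : ℕ} (κ : Fin N →₀ ℕ) (a : Fin N) (h : MvPolynomial (Fin N) ℂ) :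
    MvPolynomial.coeff κ (MvPolynomial.X a * MvPolynomial.pderiv a h) =
      κ a * MvPolynomial.coeff κ h := by
  classical
  rw [MvPolynomial.coeff_X_mul']
  split_ifs with ha
  · have h1 : 1 ≤ κ a := Nat.one_le_iff_ne_zero.2 (Finsupp.mem_support_iff.1 ha)
    rw [MvPolynomial.coeff_pderiv, tsub_add_cancel_of_le (Finsupp.single_le_iff.2 h1), mul_comm]
    congr 1
    rw [Finsupp.coe_tsub, Pi.sub_apply, Finsupp.single_eq_same, Nat.cast_sub h1]
    simp
  · rw [Finsupp.notMem_support_iff.1 ha, Nat.cast_zero, zero_mul]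

/-- `∑_a z_a ∂/∂z_a` applied to `z_aⁿ h` preserves coefficients up to the exponents. -/
theorem coeff_witt (N c n : ℕ) (h : MvPolynomial (Fin N) ℂ) :
    MvPolynomial.coeff (constExp N c)
        ((n : MvPolynomial (Fin N) ℂ) * (∑ a, (MvPolynomial.X a : MvPolynomial (Fin N) ℂ) ^ n) * h +
          witt N n h) =
      c * MvPolynomial.coeff (constExp N c) ((∑ a, MvPolynomial.X a ^ n) * h) := by
  have h1 : (n : MvPolynomial (Fin N) ℂ) * (∑ a, (MvPolynomial.X a : MvPolynomial (Fin N) ℂ) ^ n) * h +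
      witt N n h =
      ∑ a, MvPolynomial.X a * MvPolynomial.pderiv a (MvPolynomial.X a ^ n * h) := by
    rw [witt_apply, Finset.mul_sum, Finset.sum_mul, ← Finset.sum_add_distrib]
    refine Finset.sum_congr rfl fun a _ => ?_
    rw [Derivation.leibniz, Derivation.leibniz_pow, MvPolynomial.pderiv_X_self, smul_eq_mul,
      smul_eq_mul, smul_eq_mul, nsmul_eq_mul]
    cases n with
    | zero => simp
    | succ n => rw [add_tsub_cancel_right]; ring
  rw [h1, MvPolynomial.coeff_sum, Finset.sum_mul, MvPolynomial.coeff_sum, Finset.mul_sum]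
  exact Finset.sum_congr rfl fun a _ => coeff_X_mul_pderiv _ _ _

theorem sum_sum_of_symm {M : Type*} [AddCommMonoid M] {N : ℕ} (H : Fin N → Fin N → M)
    (hH : ∀ a b, H a b = H b a) :
    ∑ a, ∑ b, H a b = 2 • ∑ a, ∑ b ∈ Finset.Ioi a, H a b + ∑ a, H a a := by
  have h1 : ∀ a : Fin N, ∑ b, H a b =
      ∑ b ∈ Finset.Ioi a, H a b + ∑ b ∈ Finset.Iio a, H a b + H a a := by
    intro a
    rw [← Finset.sum_filter_add_sum_filter_not Finset.univ (fun b => a < b), add_assoc]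
    congr 1
    · exact Finset.sum_congr (by ext; simp) fun _ _ => rfl
    · rw [show Finset.univ.filter (fun b => ¬ a < b) = insert a (Finset.Iio a) by
        ext b; simp [le_iff_eq_or_lt], Finset.sum_insert (by simp), add_comm]
  have h2 : ∑ a : Fin N, ∑ b ∈ Finset.Iio a, H a b = ∑ a, ∑ b ∈ Finset.Ioi a, H a b := by
    rw [Finset.sum_comm' (t' := Finset.univ) (s' := fun b => Finset.Ioi b) (by simp)]
    exact Finset.sum_congr rfl fun a _ => Finset.sum_congr rfl fun b _ => hH _ _
  simp only [h1, Finset.sum_add_distrib, h2, two_nsmul]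

/-- `∑_{i+j=n} xⁱ yʲ`. -/
def hom2 {R : Type*} [CommRing R] (n : ℕ) (x y : R) : R :=
  ∑ i ∈ Finset.range (n + 1), x ^ i * y ^ (n + 1 - 1 - i)

theorem hom2_comm {R : Type*} [CommRing R] (n : ℕ) (x y : R) : hom2 n x y = hom2 n y x := by
  rw [hom2, hom2, ← Finset.sum_range_reflect]
  refine Finset.sum_congr rfl fun i hi => ?_
  have := Finset.mem_range.1 hi
  rw [mul_comm, show n + 1 - 1 - (n + 1 - 1 - i) = i by omega]

theorem hom2_self {R : Type*} [CommRing R] (n : ℕ) (x : R) : hom2 n x x = (n + 1 : ℕ) * x ^ n := by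
  rw [hom2, Finset.sum_congr rfl (g := fun _ => x ^ n), Finset.sum_const, Finset.card_range,
    nsmul_eq_mul]
  intro i hi
  have := Finset.mem_range.1 hi
  rw [← pow_add, show i + (n + 1 - 1 - i) = n by omega]

/-- The logarithmic derivative of the Vandermonde determinant. -/
def wittVdm (N n : ℕ) : MvPolynomial (Fin N) ℂ :=
  ∑ a, ∑ b ∈ Finset.Ioi a, hom2 n (MvPolynomial.X a) (MvPolynomial.X b)

theorem witt_vdm (N n : ℕ) : witt N n (vdm N) = wittVdm N n * vdm N := by
  refine derivation_prod_of_log _ _ _ _ fun a _ => derivation_prod_of_log _ _ _ _ fun b _ => ?_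
  rw [map_sub, witt_X, witt_X, hom2, geom_sum₂_mul]

theorem two_mul_wittVdm (N n : ℕ) :
    2 * wittVdm N n + (n + 1 : ℕ) * ∑ a, (MvPolynomial.X a : MvPolynomial (Fin N) ℂ) ^ n =
      ∑ p ∈ Finset.HasAntidiagonal.antidiagonal n,
        (∑ a, (MvPolynomial.X a : MvPolynomial (Fin N) ℂ) ^ p.1) * ∑ a, MvPolynomial.X a ^ p.2 := by
  have h := sum_sum_of_symm (fun a b : Fin N =>
    hom2 n (MvPolynomial.X a : MvPolynomial (Fin N) ℂ) (MvPolynomial.X b)) fun a b => hom2_comm _ _ _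
  simp only [hom2_self, ← Finset.mul_sum] at h
  rw [two_nsmul, ← two_mul] at h
  rw [wittVdm, ← h, Finset.Nat.sum_antidiagonal_eq_sum_range_succ_mk]
  simp only [Finset.sum_mul_sum, hom2, add_tsub_cancel_right]
  rw [Finset.sum_comm' (t' := Finset.univ) (s' := fun _ => Finset.range n.succ) (by simp)]
  refine Finset.sum_congr rfl fun a _ => ?_
  rw [Finset.sum_comm]

/-- The index `k + n`. -/
def addIdx (k : ℕ+) (n : ℕ) : ℕ+ := ⟨k + n, Nat.add_pos_left k.pos n⟩

/-- The derivation `p_k ↦ k p_{k+n}` of `V₀`. -/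
def virL (n : ℕ) : Derivation ℂ V0 V0 :=
  MvPolynomial.mkDerivation ℂ fun k : ℕ+ => (k : ℕ) • (MvPolynomial.X (addIdx k n) : V0)

theorem virL_X (n : ℕ) (k : ℕ+) :
    virL n (MvPolynomial.X k) = (k : ℕ) • MvPolynomial.X (addIdx k n) :=
  MvPolynomial.mkDerivation_X _ _ _

theorem witt_evalN (N n : ℕ) (f : V0) : witt N n (evalN N f) = evalN N (virL n f) := by
  induction f using V0.induction with
  | one => rw [map_one, Derivation.map_one_eq_zero, Derivation.map_one_eq_zero, map_zero]
  | add f g hf hg => rw [map_add, map_add, hf, hg, map_add, map_add]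
  | smul c f hf => rw [map_smul, Derivation.map_smul, hf, Derivation.map_smul, map_smul]
  | mul k f hf =>
    rw [map_mul, Derivation.leibniz, Derivation.leibniz, map_add, hf, virL_X, smul_eq_mul,
      smul_eq_mul, smul_eq_mul, smul_eq_mul, map_mul, map_mul, map_nsmul, evalN_X, evalN_X]
    congr 2
    rw [map_sum, Finset.smul_sum]
    refine Finset.sum_congr rfl fun a _ => ?_
    rw [Derivation.leibniz_pow, witt_X, smul_eq_mul, ← pow_add]
    congr 2
    have := k.pos
    change _ = (k : ℕ) + n
    omega

/-- The linear functional `f ↦ [z^κ] ∏_{a<b} (z_a - z_b)^{2α} f(z)`. -/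
def phi (α : ℕ) {N : ℕ} (κ : Fin N →₀ ℕ) : V0 →ₗ[ℂ] ℂ :=
  MvPolynomial.lcoeff ℂ κ ∘ₗ LinearMap.mulLeft ℂ (vdm N ^ (2 * α)) ∘ₗ (evalN N).toLinearMap

theorem phi_apply (α : ℕ) {N : ℕ} (κ : Fin N →₀ ℕ) (f : V0) :
    phi α κ f = MvPolynomial.coeff κ (vdm N ^ (2 * α) * evalN N f) := rfl

/-- `N + ∑_{n ≥ 1} p_n uⁿ`. -/
def psumFull (N : ℕ) : PowerSeries V0 := (N : PowerSeries V0) + psumSeries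

theorem evalN_coeff_psumFull (N n : ℕ) :
    evalN N (coeff n (psumFull N)) = ∑ a, MvPolynomial.X a ^ n := by
  rw [psumFull, map_add, psumSeries]
  rcases Nat.eq_zero_or_pos n with rfl | hn
  · rw [coeff_zero_posSeries]
    simp
  · lift n to ℕ+ using hn
    rw [coeff_posSeries, ← map_natCast (PowerSeries.C : V0 →+* PowerSeries V0),
      PowerSeries.coeff_C, if_neg n.ne_zero, zero_add, evalN_X]

/-- The multiplication part of the Virasoro constraints. -/
def quad (α N K : ℕ) : PowerSeries V0 :=
  (α : ℂ) • psumFull N ^ 2 + (1 - α : ℂ) • euler V0 (psumFull N) - (K + N * α : ℂ) • psumFull N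

/-- A functional on `V₀` that satisfies the Virasoro constraints. -/
def IsVirasoro (α N K : ℕ) (φ : V0 →ₗ[ℂ] ℂ) : Prop :=
  ∀ n f, φ (coeff n (quad α N K) * f + virL n f) = 0

theorem isVirasoro_phi (α N K : ℕ) :
    IsVirasoro α (N + 1) K (phi α (constExp (N + 1) (K + N * α))) := by
  intro n f
  set P : ℕ → MvPolynomial (Fin (N + 1)) ℂ := fun n => ∑ a, MvPolynomial.X a ^ n with hP
  set h := vdm (N + 1) ^ (2 * α) * evalN (N + 1) f with hh
  have h1 := coeff_witt (N + 1) (K + N * α) n h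
  have h2 : witt (N + 1) n h = (2 * α : ℕ) * wittVdm (N + 1) n * h +
      vdm (N + 1) ^ (2 * α) * evalN (N + 1) (virL n f) := by
    rw [hh, Derivation.leibniz, derivation_pow_of_log _ (witt_vdm _ _), witt_evalN, smul_eq_mul,
      smul_eq_mul]
    ring
  have h3 := two_mul_wittVdm (N + 1) n
  have h4 : evalN (N + 1) (coeff n (quad α (N + 1) K)) =
      (α : ℂ) • (2 * wittVdm (N + 1) n + (n + 1 : ℕ) * P n) +
        (1 - α : ℂ) • ((n : MvPolynomial (Fin (N + 1)) ℂ) * P n) -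
        (K + (N + 1 : ℕ) * α : ℂ) • P n := by
    rw [h3, quad, pow_two, map_sub, map_add, PowerSeries.coeff_smul, PowerSeries.coeff_smul,
      PowerSeries.coeff_smul, PowerSeries.coeff_mul, coeff_euler, map_sub, map_add, map_smul,
      map_smul, map_smul, map_mul, map_natCast, evalN_coeff_psumFull, map_sum]
    simp only [map_mul, evalN_coeff_psumFull, hP]
  rw [phi_apply, map_add, map_mul, h4]
  have h5 : vdm (N + 1) ^ (2 * α) * (((α : ℂ) • (2 * wittVdm (N + 1) n + (n + 1 : ℕ) * P n) +
        (1 - α : ℂ) • ((n : MvPolynomial (Fin (N + 1)) ℂ) * P n) -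
        (K + (N + 1 : ℕ) * α : ℂ) • P n) * evalN (N + 1) f + evalN (N + 1) (virL n f)) =
      ((n : MvPolynomial (Fin (N + 1)) ℂ) * P n * h + witt (N + 1) n h) -
        ((K + N * α : ℕ) : ℂ) • (P n * h) := by
    rw [h2, hh]
    simp only [Algebra.smul_def, map_sub, map_add, map_mul, map_natCast, map_one]
    push_cast
    ring
  rw [h5, MvPolynomial.coeff_sub, h1, MvPolynomial.coeff_smul, smul_eq_mul, sub_self]

theorem coeff_psumSeries_of_pos {n : ℕ} (hn : 0 < n) :
    coeff n psumSeries = MvPolynomial.X (⟨n, hn⟩ : ℕ+) := by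
  lift n to ℕ+ using hn
  exact coeff_posSeries _ _

theorem X_addIdx (k : ℕ+) (n : ℕ) :
    (MvPolynomial.X (addIdx k n) : V0) = coeff (k + n) psumSeries :=
  (coeff_psumSeries_of_pos (addIdx k n).pos).symm

theorem coeff_posSeries_addIdx (n j : ℕ) :
    coeff j (posSeries fun k => (MvPolynomial.X (addIdx k n) : V0)) =
      if j = 0 then 0 else coeff (j + n) psumSeries := by
  split_ifs with h
  · rw [h, coeff_zero_posSeries]
  · lift j to ℕ+ using Nat.pos_of_ne_zero h
    rw [coeff_posSeries, X_addIdx]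

theorem virL_coeff_gen (α : ℂ) (n m : ℕ) : virL n (coeff m (gen α)) =
    ∑ q ∈ Finset.HasAntidiagonal.antidiagonal m,
      coeff q.1 (gen α) * α • (if q.2 = 0 then 0 else coeff (q.2 + n) psumSeries) := by
  rw [← coeff_coeffDer, coeffDer_gen α (virL n) _ (virL_X n), PowerSeries.coeff_mul]
  simp only [PowerSeries.coeff_smul, coeff_posSeries_addIdx]

theorem sum_antidiagonal_rotate {M : Type*} [AddCommMonoid M] (f : ℕ → ℕ → ℕ → M) (d : ℕ) :
    ∑ p ∈ Finset.HasAntidiagonal.antidiagonal d, ∑ q ∈ Finset.HasAntidiagonal.antidiagonal p.2,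
        f p.1 q.1 q.2 =
      ∑ p ∈ Finset.HasAntidiagonal.antidiagonal d, ∑ q ∈ Finset.HasAntidiagonal.antidiagonal p.2,
        f q.2 p.1 q.1 := by
  rw [Finset.sum_sigma', Finset.sum_sigma']
  refine Finset.sum_nbij' (fun x => ⟨(x.2.1, x.1.1 + x.2.2), (x.2.2, x.1.1)⟩)
    (fun x => ⟨(x.2.2, x.1.1 + x.2.1), (x.1.1, x.2.1)⟩) ?_ ?_ ?_ ?_ ?_
  · rintro ⟨⟨a, b⟩, ⟨c, e⟩⟩ h
    simp only [Finset.mem_sigma, Finset.HasAntidiagonal.mem_antidiagonal] at h ⊢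
    constructor <;> omega
  · rintro ⟨⟨a, b⟩, ⟨c, e⟩⟩ h
    simp only [Finset.mem_sigma, Finset.HasAntidiagonal.mem_antidiagonal] at h ⊢
    exact ⟨by omega, trivial⟩
  · rintro ⟨⟨a, b⟩, ⟨c, e⟩⟩ h
    simp only [Finset.mem_sigma, Finset.HasAntidiagonal.mem_antidiagonal] at h
    obtain ⟨-, rfl⟩ := h
    rfl
  · rintro ⟨⟨a, b⟩, ⟨c, e⟩⟩ h
    simp only [Finset.mem_sigma, Finset.HasAntidiagonal.mem_antidiagonal] at h
    obtain ⟨-, rfl⟩ := h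
    simp [add_comm]
  · intro x _
    rfl

theorem sum_virL_gen (α : ℂ) (d : ℕ) :
    ∑ p ∈ Finset.HasAntidiagonal.antidiagonal d, virL p.1 (coeff p.2 (gen α)) =
      α • coeff d (gen α * euler V0 psumSeries) := by
  simp only [virL_coeff_gen]
  rw [sum_antidiagonal_rotate (fun n i j => coeff i (gen α) *
    α • (if j = 0 then 0 else coeff (j + n) psumSeries)), PowerSeries.coeff_mul, Finset.smul_sum]
  refine Finset.sum_congr rfl fun p _ => ?_
  rw [← Finset.mul_sum, ← Finset.smul_sum, mul_smul_comm, coeff_euler]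
  congr 2
  rw [Finset.Nat.sum_antidiagonal_eq_sum_range_succ_mk, Finset.sum_range_succ', if_pos rfl, add_zero,
    Finset.sum_congr rfl (g := fun _ => coeff p.2 psumSeries), Finset.sum_const, Finset.card_range,
    nsmul_eq_mul]
  intro i hi
  have := Finset.mem_range.1 hi
  rw [if_neg (by omega), show i + 1 + (p.2 - (i + 1)) = p.2 by omega]

/-- The second order differential equation satisfied by the generating function. -/
theorem quad_gen (α N K : ℕ) : (α : ℂ) • (quad α N K * gen α +
      (α : ℂ) • (gen α * euler V0 psumSeries)) =
    euler V0 (euler V0 (gen α)) + (α * N - K : ℂ) • euler V0 (gen α) -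
      (K * (α * N) : ℂ) • gen α := by
  have h1 : euler V0 (psumFull N) = euler V0 psumSeries := by
    rw [psumFull, map_add, Derivation.map_natCast, zero_add]
  have h2 : psumSeries = psumFull N - (N : PowerSeries V0) := by rw [psumFull]; ring
  rw [quad, h1, euler_gen, Derivation.leibniz, euler_gen, Derivation.map_smul]
  simp only [smul_eq_mul, Algebra.smul_def, map_sub, map_add, map_mul, map_natCast, map_one]
  generalize euler V0 psumSeries = E
  rw [h2]
  ring

theorem sum_virasoro_gen (α N K d : ℕ) (h : V0) :
    (α : ℂ) • ∑ p ∈ Finset.HasAntidiagonal.antidiagonal d,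
        (coeff p.1 (quad α N K) * (coeff p.2 (gen α) * h) + virL p.1 (coeff p.2 (gen α) * h)) =
      (((d : ℂ) - K) * (d + α * N)) • (coeff d (gen α) * h) +
        (α : ℂ) • ∑ p ∈ Finset.HasAntidiagonal.antidiagonal d, coeff p.2 (gen α) * virL p.1 h := by
  have h1 := congrArg (coeff d) (quad_gen α N K)
  rw [PowerSeries.coeff_smul, map_add, PowerSeries.coeff_mul, PowerSeries.coeff_smul,
    ← sum_virL_gen, map_sub, map_add, PowerSeries.coeff_smul, PowerSeries.coeff_smul, coeff_euler,
    coeff_euler, ← Finset.sum_add_distrib] at h1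
  have h2 : ∀ p : ℕ × ℕ,
      coeff p.1 (quad α N K) * (coeff p.2 (gen α) * h) + virL p.1 (coeff p.2 (gen α) * h) =
      (coeff p.1 (quad α N K) * coeff p.2 (gen α) + virL p.1 (coeff p.2 (gen α))) * h +
        coeff p.2 (gen α) * virL p.1 h := by
    intro p
    rw [Derivation.leibniz, smul_eq_mul, smul_eq_mul]
    ring
  rw [Finset.sum_congr rfl fun p _ => h2 p, Finset.sum_add_distrib, smul_add, ← Finset.sum_mul,
    ← smul_mul_assoc, h1]
  congr 1
  simp only [Algebra.smul_def, map_sub, map_add, map_mul, map_natCast]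
  ring

/-- The ideal generated by the coefficients of `gen α` of degree greater than `d`. -/
def genIdeal (α : ℂ) (d : ℕ) : Ideal V0 := Ideal.span {g | ∃ m, d < m ∧ g = coeff m (gen α)}

theorem sum_gen_mul_X_mem {α : ℂ} (hα : α ≠ 0) (d : ℕ) (k : ℕ+) :
    ∑ p ∈ Finset.HasAntidiagonal.antidiagonal d,
      coeff p.2 (gen α) * MvPolynomial.X (addIdx k p.1) ∈ genIdeal α d := by
  have hmem : ∀ m, d < m → coeff m (gen α) ∈ genIdeal α d := fun m hm =>
    Ideal.subset_span ⟨m, hm, rfl⟩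
  have h1 := congrArg (coeff (d + k)) (euler_gen α)
  rw [coeff_euler, smul_mul_assoc, PowerSeries.coeff_smul, PowerSeries.coeff_mul,
    ← Finset.sum_filter_add_sum_filter_not _ fun p : ℕ × ℕ => p.2 ≤ d] at h1
  have h2 : ∑ p ∈ (Finset.HasAntidiagonal.antidiagonal (d + (k : ℕ))).filter (fun p => p.2 ≤ d),
      coeff p.1 psumSeries * coeff p.2 (gen α) = ∑ p ∈ Finset.HasAntidiagonal.antidiagonal d,
        coeff p.2 (gen α) * MvPolynomial.X (addIdx k p.1) := by
    refine Finset.sum_nbij' (fun p => (p.1 - k, p.2)) (fun p => (k + p.1, p.2)) ?_ ?_ ?_ ?_ ?_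
    · rintro ⟨a, b⟩ h
      simp only [Finset.mem_filter, Finset.HasAntidiagonal.mem_antidiagonal] at h ⊢
      omega
    · rintro ⟨a, b⟩ h
      simp only [Finset.mem_filter, Finset.HasAntidiagonal.mem_antidiagonal] at h ⊢
      omega
    · rintro ⟨a, b⟩ h
      simp only [Finset.mem_filter, Finset.HasAntidiagonal.mem_antidiagonal, Prod.mk.injEq,
        and_true] at h ⊢
      omega
    · rintro ⟨a, b⟩ h
      simp
    · rintro ⟨a, b⟩ h
      simp only [Finset.mem_filter, Finset.HasAntidiagonal.mem_antidiagonal] at h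
      rw [X_addIdx, mul_comm]
      congr 3
      show a = k + (a - k)
      omega
  rw [h2] at h1
  set x := ∑ p ∈ Finset.HasAntidiagonal.antidiagonal d,
    coeff p.2 (gen α) * (MvPolynomial.X (addIdx k p.1) : V0)
  have h3 : α • x ∈ genIdeal α d := by
    rw [smul_add] at h1
    rw [eq_sub_iff_add_eq.2 h1.symm]
    refine sub_mem (Ideal.mul_mem_left _ _ (hmem _ (by have := k.pos; omega))) ?_
    rw [MvPolynomial.smul_eq_C_mul]
    refine Ideal.mul_mem_left _ _ (sum_mem fun p hp => Ideal.mul_mem_left _ _ (hmem _ ?_))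
    simpa using (Finset.mem_filter.1 hp).2
  have h4 := Ideal.mul_mem_left _ (MvPolynomial.C α⁻¹) h3
  rwa [← MvPolynomial.smul_eq_C_mul, smul_smul, inv_mul_cancel₀ hα, one_smul] at h4

theorem sum_gen_mul_virL_mem {α : ℂ} (hα : α ≠ 0) (d : ℕ) (h : V0) :
    ∑ p ∈ Finset.HasAntidiagonal.antidiagonal d, coeff p.2 (gen α) * virL p.1 h ∈
      genIdeal α d := by
  induction h using V0.induction with
  | one => simp
  | add f g hf hg =>
    simp only [map_add, mul_add, Finset.sum_add_distrib]
    exact add_mem hf hg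
  | smul c f hf =>
    simp only [Derivation.map_smul, mul_smul_comm, ← Finset.smul_sum]
    rw [MvPolynomial.smul_eq_C_mul]
    exact Ideal.mul_mem_left _ _ hf
  | mul k f hf =>
    have h1 : ∀ p : ℕ × ℕ, coeff p.2 (gen α) * virL p.1 (MvPolynomial.X k * f) =
        MvPolynomial.X k * (coeff p.2 (gen α) * virL p.1 f) +
          (((k : ℕ) : V0) * f) * (coeff p.2 (gen α) * MvPolynomial.X (addIdx k p.1)) := by
      intro p
      rw [Derivation.leibniz, virL_X, smul_eq_mul, smul_eq_mul, nsmul_eq_mul]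
      ring
    simp only [h1, Finset.sum_add_distrib, ← Finset.mul_sum]
    exact add_mem (Ideal.mul_mem_left _ _ hf)
      (Ideal.mul_mem_left _ _ (sum_gen_mul_X_mem hα d k))

theorem addIdx_zero (k : ℕ+) : addIdx k 0 = k := rfl

theorem virL_zero_gen (α : ℂ) (d : ℕ) :
    virL 0 (coeff d (gen α)) = (d : ℂ) • coeff d (gen α) := by
  rw [← coeff_coeffDer, coeffDer_gen α (virL 0) _ (virL_X 0), Nat.cast_smul_eq_nsmul, nsmul_eq_mul,
    ← coeff_euler, euler_gen, mul_comm]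
  rfl

theorem IsVirasoro.virL_zero {α N K : ℕ} {φ : V0 →ₗ[ℂ] ℂ} (hφ : IsVirasoro α N K φ) (f : V0) :
    φ (virL 0 f) = (K * N : ℂ) * φ f := by
  have h := hφ 0 f
  have h1 : coeff 0 (psumFull N) = (N : V0) := by
    rw [psumFull, map_add, psumSeries, coeff_zero_posSeries, add_zero,
      ← map_natCast (PowerSeries.C : V0 →+* PowerSeries V0), PowerSeries.coeff_C, if_pos rfl]
  have h2 : coeff 0 (quad α N K) = MvPolynomial.C (-(K * N) : ℂ) := by
    rw [quad, map_sub, map_add, PowerSeries.coeff_smul, PowerSeries.coeff_smul,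
      PowerSeries.coeff_smul, coeff_euler, pow_two, PowerSeries.coeff_mul,
      Finset.Nat.antidiagonal_zero, Finset.sum_singleton, h1]
    simp only [MvPolynomial.smul_eq_C_mul, map_neg, map_mul, map_add, map_natCast]
    push_cast
    ring
  rw [h2, ← MvPolynomial.smul_eq_C_mul, map_add, map_smul, smul_eq_mul] at h
  linear_combination h

theorem IsVirasoro.eq_zero_of_weight {α N K : ℕ} {φ : V0 →ₗ[ℂ] ℂ} (hφ : IsVirasoro α N K φ)
    (h : V0) : ∀ (f : V0) (w : ℕ), virL 0 f = (w : ℂ) • f → K * N < w → φ (f * h) = 0 := by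
  induction h using V0.induction with
  | one =>
    intro f w hf hw
    have := hφ.virL_zero f
    rw [hf, map_smul, smul_eq_mul, ← sub_eq_zero, ← sub_mul] at this
    rw [mul_one]
    refine (mul_eq_zero.1 this).resolve_left fun h0 => ?_
    have h0' : ((w : ℕ) : ℂ) = ((K * N : ℕ) : ℂ) := by push_cast; exact sub_eq_zero.1 h0
    have : w = K * N := by exact_mod_cast h0'
    omega
  | add g g' hg hg' => intro f w hf hw; rw [mul_add, map_add, hg f w hf hw, hg' f w hf hw, add_zero]
  | smul c g hg => intro f w hf hw; rw [mul_smul_comm, map_smul, hg f w hf hw, smul_zero]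
  | mul k g hg =>
    intro f w hf hw
    rw [← mul_assoc]
    refine hg _ (w + k) ?_ (by omega)
    rw [Derivation.leibniz, hf, virL_X, addIdx_zero, smul_eq_mul, smul_eq_mul, nsmul_eq_mul]
    simp only [Algebra.smul_def, map_natCast]
    push_cast
    ring

/-- A functional that satisfies the Virasoro constraints kills the ideals generated by the
coefficients of large degree of the generating function. -/
theorem IsVirasoro.gen_mul_eq_zero {α N K : ℕ} (hα : 0 < α) {φ : V0 →ₗ[ℂ] ℂ}
    (hφ : IsVirasoro α N K φ) {d : ℕ} (hd : K < d) (h : V0) : φ (coeff d (gen α) * h) = 0 := by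
  induction hn : K * N - d using Nat.strong_induction_on generalizing d h with
  | _ n ih =>
    by_cases hK : K * N < d
    · exact hφ.eq_zero_of_weight h _ d (virL_zero_gen α d) hK
    have hα' : (α : ℂ) ≠ 0 := by exact_mod_cast hα.ne'
    have hI : ∀ x ∈ genIdeal α d, φ x = 0 := by
      intro x hx
      refine Submodule.span_induction (p := fun x _ => ∀ y, φ (x * y) = 0) ?_ (by simp) ?_ ?_ hx 1
        |> fun h => by rwa [mul_one] at h
      · rintro _ ⟨m, hm, rfl⟩ y
        by_cases hK' : K * N < m
        · exact hφ.eq_zero_of_weight y _ m (virL_zero_gen α m) hK'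
        · exact ih (K * N - m) (by omega) (hd.trans hm) y rfl
      · intro a b _ _ ha hb y
        rw [add_mul, map_add, ha, hb, add_zero]
      · intro c a _ ha y
        rw [smul_eq_mul, mul_comm c, mul_assoc, ha]
    have key := congrArg φ (sum_virasoro_gen α N K d h)
    rw [map_smul, map_sum, Finset.sum_eq_zero fun p _ => hφ _ _, smul_zero, map_add, map_smul,
      map_smul, hI _ (sum_gen_mul_virL_mem hα' d h), smul_zero, add_zero, smul_eq_mul] at key
    refine (mul_eq_zero.1 key.symm).resolve_left (mul_ne_zero ?_ ?_)
    · rw [sub_ne_zero]; exact_mod_cast hd.ne'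
    · have : d + α * N ≠ 0 := by omega
      exact_mod_cast this

/-! ### Nonvanishing -/

/-- `P` is palindromic up to the sign `ε`: reversing exponents with respect to `v` multiplies the
coefficients by `ε`. -/
def IsPal {σ : Type*} (P : MvPolynomial σ ℂ) (ε : ℂ) (v : σ →₀ ℕ) : Prop :=
  (∀ c, MvPolynomial.coeff c P ≠ 0 → c ≤ v) ∧
    ∀ a b, a + b = v → MvPolynomial.coeff a P = ε * MvPolynomial.coeff b P

theorem isPal_one {σ : Type*} : IsPal (1 : MvPolynomial σ ℂ) 1 0 := by
  classical
  refine ⟨fun c hc => ?_, fun a b h => ?_⟩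
  · rw [MvPolynomial.coeff_one] at hc
    by_contra h
    exact hc (if_neg fun h' => h h'.symm.le)
  · obtain ⟨rfl, rfl⟩ := add_eq_zero.1 h
    rw [one_mul]

theorem IsPal.mul {σ : Type*} {P Q : MvPolynomial σ ℂ} {ε δ : ℂ} {v w : σ →₀ ℕ}
    (hP : IsPal P ε v) (hQ : IsPal Q δ w) : IsPal (P * Q) (ε * δ) (v + w) := by
  classical
  refine ⟨fun c hc => ?_, fun a b hab => ?_⟩
  · rw [MvPolynomial.coeff_mul] at hc
    obtain ⟨p, hp, hp'⟩ := Finset.exists_ne_zero_of_sum_ne_zero hc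
    rw [← Finset.HasAntidiagonal.mem_antidiagonal.1 hp]
    exact add_le_add (hP.1 _ (left_ne_zero_of_mul hp')) (hQ.1 _ (right_ne_zero_of_mul hp'))
  · have hfil : ∀ c, MvPolynomial.coeff c (P * Q) =
        ∑ p ∈ (Finset.HasAntidiagonal.antidiagonal c).filter (fun p => p.1 ≤ v ∧ p.2 ≤ w),
          MvPolynomial.coeff p.1 P * MvPolynomial.coeff p.2 Q := by
      intro c
      rw [MvPolynomial.coeff_mul, Finset.sum_filter_of_ne]
      intro p _ hp
      exact ⟨hP.1 _ (left_ne_zero_of_mul hp), hQ.1 _ (right_ne_zero_of_mul hp)⟩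
    have hmem : ∀ {a b : σ →₀ ℕ}, a + b = v + w → ∀ p ∈
        (Finset.HasAntidiagonal.antidiagonal a).filter (fun p => p.1 ≤ v ∧ p.2 ≤ w),
        (v - p.1, w - p.2) ∈
        (Finset.HasAntidiagonal.antidiagonal b).filter (fun p => p.1 ≤ v ∧ p.2 ≤ w) := by
      intro a b hab p hp
      rw [Finset.mem_filter, Finset.HasAntidiagonal.mem_antidiagonal] at hp ⊢
      obtain ⟨h1, h2, h3⟩ := hp
      refine ⟨?_, tsub_le_self, tsub_le_self⟩
      ext i
      have e1 := DFunLike.congr_fun h1 i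
      have e2 := DFunLike.congr_fun hab i
      have e3 := h2 i
      have e4 := h3 i
      simp only [Finsupp.coe_add, Pi.add_apply, Finsupp.coe_tsub, Pi.sub_apply] at *
      omega
    have hinv : ∀ {a : σ →₀ ℕ}, ∀ p ∈
        (Finset.HasAntidiagonal.antidiagonal a).filter (fun p => p.1 ≤ v ∧ p.2 ≤ w),
        (v - (v - p.1), w - (w - p.2)) = p := by
      intro a p hp
      rw [Finset.mem_filter] at hp
      rw [tsub_tsub_cancel_of_le hp.2.1, tsub_tsub_cancel_of_le hp.2.2]
    rw [hfil, hfil, Finset.mul_sum]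
    refine Finset.sum_nbij' (fun p => (v - p.1, w - p.2)) (fun p => (v - p.1, w - p.2))
      (hmem hab) (hmem (by rw [add_comm, hab])) hinv hinv ?_
    intro p hp
    rw [Finset.mem_filter] at hp
    rw [hP.2 p.1 (v - p.1) (add_tsub_cancel_of_le hp.2.1),
      hQ.2 p.2 (w - p.2) (add_tsub_cancel_of_le hp.2.2)]
    ring

theorem IsPal.prod {σ ι : Type*} {P : ι → MvPolynomial σ ℂ} {ε : ι → ℂ} {v : ι → σ →₀ ℕ}
    (s : Finset ι) (h : ∀ i ∈ s, IsPal (P i) (ε i) (v i)) :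
    IsPal (∏ i ∈ s, P i) (∏ i ∈ s, ε i) (∑ i ∈ s, v i) := by
  classical
  induction s using Finset.induction_on with
  | empty => exact isPal_one
  | insert i s hi ih =>
    rw [Finset.prod_insert hi, Finset.prod_insert hi, Finset.sum_insert hi]
    exact (h i (by simp)).mul (ih fun j hj => h j (by simp [hj]))

theorem IsPal.pow {σ : Type*} {P : MvPolynomial σ ℂ} {ε : ℂ} {v : σ →₀ ℕ} (h : IsPal P ε v)
    (k : ℕ) : IsPal (P ^ k) (ε ^ k) (k • v) := by
  have := IsPal.prod (Finset.range k) fun i _ => h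
  simpa using this

theorem isPal_X_sub_X {σ : Type*} (a b : σ) :
    IsPal (MvPolynomial.X a - MvPolynomial.X b) (-1) (Finsupp.single a 1 + Finsupp.single b 1) := by
  classical
  refine ⟨fun c hc => ?_, fun c d h => ?_⟩
  · rw [MvPolynomial.coeff_sub, MvPolynomial.coeff_X, MvPolynomial.coeff_X] at hc
    by_cases h1 : Finsupp.single a 1 = c
    · rw [← h1]; exact le_self_add
    by_cases h2 : Finsupp.single b 1 = c
    · rw [← h2]; exact le_add_self
    rw [if_neg h1, if_neg h2, sub_zero] at hc
    exact absurd rfl hc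
  · have h1 : Finsupp.single a 1 = c ↔ Finsupp.single b 1 = d := by
      constructor
      · rintro rfl; exact (add_left_cancel h).symm
      · rintro rfl; exact (add_right_cancel h).symm
    have h2 : Finsupp.single b 1 = c ↔ Finsupp.single a 1 = d := by
      rw [add_comm (Finsupp.single a 1)] at h
      constructor
      · rintro rfl; exact (add_left_cancel h).symm
      · rintro rfl; exact (add_right_cancel h).symm
    simp only [MvPolynomial.coeff_sub, MvPolynomial.coeff_X, h1, h2]
    ring

theorem exists_isPal_vdm (N : ℕ) : ∃ ε : ℂ, ε ≠ 0 ∧ IsPal (vdm (N + 1)) ε (constExp (N + 1) N) := by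
  refine ⟨∏ a : Fin (N + 1), ∏ b ∈ Finset.Ioi a, (-1), ?_, ?_⟩
  · exact Finset.prod_ne_zero_iff.2 fun _ _ => Finset.prod_ne_zero_iff.2 fun _ _ => by simp
  · have h : constExp (N + 1) N = ∑ a : Fin (N + 1), ∑ b ∈ Finset.Ioi a,
        (Finsupp.single a 1 + Finsupp.single b 1) := by
      ext c
      have key := sum_sum_of_symm (fun a b : Fin (N + 1) =>
        (Finsupp.single a 1 c + Finsupp.single b 1 c : ℕ)) fun a b => add_comm _ _
      simp only [Finset.sum_add_distrib, Finsupp.single_apply, Finset.sum_ite_eq',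
        Finset.mem_univ, if_true, Finset.sum_const, Finset.card_univ, Fintype.card_fin,
        smul_eq_mul, mul_one] at key
      simp only [constExp_apply, Finsupp.finsetSum_apply, Finsupp.coe_add, Pi.add_apply,
        Finsupp.single_apply, Finset.sum_add_distrib]
      simp at key ⊢
      omega
    rw [h]
    exact IsPal.prod _ fun a _ => IsPal.prod _ fun b _ => isPal_X_sub_X a b

theorem vdm_ne_zero (N : ℕ) : vdm N ≠ 0 :=
  Finset.prod_ne_zero_iff.2 fun _ _ => Finset.prod_ne_zero_iff.2 fun _ hb =>
    sub_ne_zero.2 fun h => (Finset.mem_Ioi.1 hb).ne (MvPolynomial.X_injective h)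

theorem map_conj_vdm (N : ℕ) : MvPolynomial.map (starRingEnd ℂ) (vdm N) = vdm N := by
  simp [vdm, map_prod]

/-- The constant term of `∏_{a ≠ b} (1 - z_a / z_b)^α` does not vanish. -/
theorem coeff_vdm_pow_ne_zero (N α : ℕ) :
    MvPolynomial.coeff (constExp (N + 1) (N * α)) (vdm (N + 1) ^ (2 * α)) ≠ 0 := by
  classical
  obtain ⟨ε, hε, hpal⟩ := exists_isPal_vdm N
  set P := vdm (N + 1) ^ α with hP
  have h1 : IsPal P (ε ^ α) (constExp (N + 1) (N * α)) := by
    have := hpal.pow α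
    rwa [show α • constExp (N + 1) N = constExp (N + 1) (N * α) by
      ext a; simp [constExp_apply, mul_comm]] at this
  have hconj : ∀ c, starRingEnd ℂ (MvPolynomial.coeff c P) = MvPolynomial.coeff c P := by
    intro c
    rw [← MvPolynomial.coeff_map, hP, map_pow, map_conj_vdm]
  have h2 : MvPolynomial.coeff (constExp (N + 1) (N * α)) (vdm (N + 1) ^ (2 * α)) =
      ε ^ α * ((∑ p ∈ Finset.HasAntidiagonal.antidiagonal (constExp (N + 1) (N * α)),
        Complex.normSq (MvPolynomial.coeff p.2 P) : ℝ) : ℂ) := by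
    rw [mul_comm 2 α, pow_mul, ← hP, pow_two, MvPolynomial.coeff_mul, Complex.ofReal_sum,
      Finset.mul_sum]
    refine Finset.sum_congr rfl fun p hp => ?_
    rw [h1.2 _ _ (Finset.HasAntidiagonal.mem_antidiagonal.1 hp), ← Complex.mul_conj, hconj, mul_assoc]
  rw [h2]
  refine mul_ne_zero (pow_ne_zero _ hε) ?_
  rw [Ne, Complex.ofReal_eq_zero, Finset.sum_eq_zero_iff_of_nonneg
    fun _ _ => Complex.normSq_nonneg _]
  intro h0
  refine pow_ne_zero α (vdm_ne_zero (N + 1)) (MvPolynomial.ext _ _ fun c => ?_)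
  rw [MvPolynomial.coeff_zero]
  by_contra hc
  have hle := h1.1 c hc
  exact hc (Complex.normSq_eq_zero.1 (h0 (_ - c, c)
    (Finset.HasAntidiagonal.mem_antidiagonal.2 (tsub_add_cancel_of_le hle))))

/-! ### Coefficients of symmetric functions -/

theorem expType_eq_single_iff (e : ℕ →₀ ℕ) (n : ℕ+) :
    expType e = Finsupp.single n 1 ↔ ∃ i, e = Finsupp.single i (n : ℕ) := by
  constructor
  · intro h
    have h1 := len_expType e
    have h2 := wt_expType e
    rw [h, ← part_pos, len_part n.ne_zero] at h1
    rw [h, ← part_pos, wt_part] at h2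
    obtain ⟨i, b, -, rfl⟩ := Finsupp.card_support_eq_one'.1 h1.symm
    refine ⟨i, ?_⟩
    rw [Finsupp.degree_single] at h2
    rw [h2]
  · rintro ⟨i, rfl⟩
    exact expType_single i n

theorem coeff_psum_mul (n : ℕ+) (h : Lam) (e : ℕ →₀ ℕ) :
    MvPowerSeries.coeff e ((psum n * h : Lam) : MvPowerSeries ℕ ℂ) =
      ∑ i ∈ e.support, if (n : ℕ) ≤ e i then
        MvPowerSeries.coeff (e - Finsupp.single i (n : ℕ)) (h : MvPowerSeries ℕ ℂ) else 0 := by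
  classical
  rw [MulMemClass.coe_mul, MvPowerSeries.coeff_mul, ← Finset.sum_filter]
  simp only [psum, coeff_mono, ite_mul, one_mul, zero_mul]
  rw [← Finset.sum_filter]
  symm
  refine Finset.sum_nbij (fun i => (Finsupp.single i (n : ℕ), e - Finsupp.single i (n : ℕ)))
    ?_ ?_ ?_ ?_
  · intro i hi
    rw [Finset.mem_filter] at hi ⊢
    exact ⟨Finset.HasAntidiagonal.mem_antidiagonal.2
      (add_tsub_cancel_of_le (Finsupp.single_le_iff.2 hi.2)), expType_single i n⟩
  · intro i _ j _ hij
    exact Finsupp.single_left_injective n.ne_zero (Prod.mk.inj hij).1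
  · rintro ⟨a, b⟩ hp
    rw [Finset.mem_coe, Finset.mem_filter, Finset.HasAntidiagonal.mem_antidiagonal] at hp
    obtain ⟨rfl, h2⟩ := hp
    obtain ⟨i, rfl⟩ := (expType_eq_single_iff _ _).1 h2
    refine ⟨i, ?_, ?_⟩
    · rw [Finset.mem_coe, Finset.mem_filter, Finsupp.mem_support_iff]
      have := n.pos
      simp
    · simp
  · intro i _
    rfl

/-- The exponents of `N` variables as exponents of infinitely many variables. -/
def embExp {N : ℕ} (c : Fin N →₀ ℕ) : ℕ →₀ ℕ := Finsupp.embDomain Fin.valEmbedding c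

theorem embExp_apply {N : ℕ} (c : Fin N →₀ ℕ) (a : Fin N) : embExp c (a : ℕ) = c a :=
  Finsupp.embDomain_apply_self Fin.valEmbedding c a

theorem embExp_sub_single {N : ℕ} (c : Fin N →₀ ℕ) (a : Fin N) (n : ℕ) :
    embExp (c - Finsupp.single a n) = embExp c - Finsupp.single (a : ℕ) n := by
  classical
  ext i
  rw [Finsupp.coe_tsub, Pi.sub_apply]
  by_cases h : i < N
  · lift i to Fin N using h
    rw [embExp_apply, embExp_apply, Finsupp.coe_tsub, Pi.sub_apply, Finsupp.single_apply,
      Finsupp.single_apply]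
    simp only [Fin.val_inj]
  · have hr : i ∉ Set.range (Fin.valEmbedding : Fin N ↪ ℕ) := by
      rintro ⟨b, rfl⟩
      exact h b.2
    rw [embExp, embExp, Finsupp.embDomain_of_notMem_range _ _ _ hr,
      Finsupp.embDomain_of_notMem_range _ _ _ hr, zero_tsub]

theorem coeff_evalN {N : ℕ} (f : V0) (c : Fin N →₀ ℕ) : MvPolynomial.coeff c (evalN N f) =
    MvPowerSeries.coeff (embExp c) (toLam f : MvPowerSeries ℕ ℂ) := by
  classical
  induction f using V0.induction generalizing c with
  | one =>
    rw [map_one, map_one, MvPolynomial.coeff_one,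
      show ((1 : Lam) : MvPowerSeries ℕ ℂ) = 1 from rfl, MvPowerSeries.coeff_one]
    refine if_congr ?_ rfl rfl
    rw [eq_comm, embExp, Finsupp.embDomain_eq_zero]
  | add f g hf hg => rw [map_add, map_add, MvPolynomial.coeff_add, hf, hg]; rfl
  | smul r f hf => rw [map_smul, map_smul, MvPolynomial.coeff_smul, hf]; rfl
  | mul n f hf =>
    rw [map_mul, map_mul, evalN_X, Finset.sum_mul, MvPolynomial.coeff_sum,
      show toLam (MvPolynomial.X n) = psum n from MvPolynomial.aeval_X _ _, coeff_psum_mul, embExp,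
      Finsupp.support_embDomain, Finset.sum_map]
    have h1 : ∀ a, MvPolynomial.coeff c (MvPolynomial.X a ^ (n : ℕ) * evalN N f) =
        if (n : ℕ) ≤ c a then MvPowerSeries.coeff (embExp c - Finsupp.single (a : ℕ) (n : ℕ))
          (toLam f : MvPowerSeries ℕ ℂ) else 0 := by
      intro a
      rw [MvPolynomial.X_pow_eq_monomial, MvPolynomial.coeff_monomial_mul', one_mul, hf,
        embExp_sub_single]
      exact if_congr Finsupp.single_le_iff rfl rfl
    simp only [h1]
    symm
    refine (Finset.sum_subset (Finset.subset_univ _) fun a _ ha => ?_).trans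
      (Finset.sum_congr rfl fun a _ => ?_)
    · rw [Finsupp.embDomain_apply_self, if_neg]
      rw [Finsupp.notMem_support_iff.1 ha]
      exact not_le.2 n.pos
    · rw [Finsupp.embDomain_apply_self]
      rfl

/-- Extraction of the variable `x_i`. -/
theorem coeff_toLam_erase (f : V0) (e : ℕ →₀ ℕ) (i : ℕ) :
    MvPowerSeries.coeff e (toLam f : MvPowerSeries ℕ ℂ) =
      MvPowerSeries.coeff (e.erase i) (toLam (coeff (e i) (transl f)) : MvPowerSeries ℕ ℂ) := by
  classical
  induction f using V0.induction generalizing e with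
  | one =>
    have h1 : ((1 : Lam) : MvPowerSeries ℕ ℂ) = 1 := rfl
    rw [coeff_transl_one, map_one, h1, MvPowerSeries.coeff_one]
    by_cases hi : e i = 0
    · rw [if_pos hi, map_one, h1, MvPowerSeries.coeff_one, Finsupp.erase_of_notMem_support
        (Finsupp.notMem_support_iff.2 hi)]
    · rw [if_neg hi, map_zero, if_neg (fun h => hi (by rw [h]; rfl))]
      rfl
  | add f g hf hg =>
    have h := congrArg₂ (· + ·) (hf e) (hg e)
    simp only [← map_add, ← AddMemClass.coe_add] at h
    simpa only [← map_add] using h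
  | smul r f hf =>
    have h := congrArg (r * ·) (hf e)
    simp only [← smul_eq_mul, ← Subalgebra.coe_smul,
      ← map_smul, ← PowerSeries.coeff_smul] at h
    exact h
  | mul n f hf =>
    have hX : ∀ g : V0, toLam (MvPolynomial.X n * g) = psum n * toLam g := fun g => by
      rw [map_mul, show toLam (MvPolynomial.X n) = psum n from MvPolynomial.aeval_X _ _]
    rw [hX, coeff_psum_mul, coeff_transl_X_mul, map_add, hX, AddMemClass.coe_add, map_add,
      coeff_psum_mul, Finsupp.support_erase]
    have h1 : ∀ k ∈ e.support.erase i, (if (n : ℕ) ≤ e.erase i k then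
        MvPowerSeries.coeff (e.erase i - Finsupp.single k (n : ℕ))
          (toLam (coeff (e i) (transl f)) : MvPowerSeries ℕ ℂ) else 0) =
        if (n : ℕ) ≤ e k then MvPowerSeries.coeff (e - Finsupp.single k (n : ℕ))
          (toLam f : MvPowerSeries ℕ ℂ) else 0 := by
      intro k hk
      have hki := Finset.ne_of_mem_erase hk
      rw [Finsupp.erase_ne hki]
      split_ifs
      · rw [hf (e - Finsupp.single k (n : ℕ))]
        congr 2
        · ext j
          by_cases hj : j = i
          · subst hj; simp [hki.symm]
          · simp [Finsupp.erase_ne hj]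
        · simp [hki]
      · rfl
    rw [Finset.sum_congr rfl h1]
    have h2 : ∀ x : ℕ →₀ ℕ, x = e.erase i → MvPowerSeries.coeff x
        (toLam (if (n : ℕ) ≤ e i then coeff (e i - n) (transl f) else 0) : MvPowerSeries ℕ ℂ) =
        if (n : ℕ) ≤ e i then MvPowerSeries.coeff (e - Finsupp.single i (n : ℕ))
          (toLam f : MvPowerSeries ℕ ℂ) else 0 := by
      rintro x rfl
      split_ifs
      · rw [hf (e - Finsupp.single i (n : ℕ))]
        have h3 : (e - Finsupp.single i (n : ℕ)).erase i = e.erase i := by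
          ext j
          by_cases hj : j = i
          · subst hj; simp
          · simp [Finsupp.erase_ne hj, Ne.symm hj]
        rw [h3]
        simp
      · rw [map_zero]; exact map_zero _
    rw [h2 _ rfl]
    by_cases hi : i ∈ e.support
    · rw [Finset.sum_erase_add _ _ hi]
    · rw [Finset.erase_eq_of_notMem hi, if_neg, add_zero]
      rw [Finsupp.notMem_support_iff.1 hi]
      exact not_le.2 n.pos

/-! ### Symmetry -/

theorem rename_evalN {N : ℕ} (σ : Equiv.Perm (Fin N)) (f : V0) :
    MvPolynomial.rename σ (evalN N f) = evalN N f := by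
  have : (MvPolynomial.rename σ).comp (evalN N) = evalN N := by
    refine MvPolynomial.algHom_ext fun n => ?_
    rw [AlgHom.comp_apply, evalN_X, map_sum]
    simp only [map_pow, MvPolynomial.rename_X]
    exact Equiv.sum_comp σ fun a => (MvPolynomial.X a : MvPolynomial (Fin N) ℂ) ^ (n : ℕ)
  exact DFunLike.congr_fun this f

theorem vdm_sq (N : ℕ) : vdm N ^ 2 =
    (Matrix.vandermonde fun a : Fin N => (MvPolynomial.X a : MvPolynomial (Fin N) ℂ)).det ^ 2 := by
  rw [Matrix.det_vandermonde, vdm, ← Finset.prod_pow, ← Finset.prod_pow]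
  refine Finset.prod_congr rfl fun a _ => ?_
  rw [← Finset.prod_pow, ← Finset.prod_pow]
  exact Finset.prod_congr rfl fun b _ => by ring

theorem rename_vdm_sq {N : ℕ} (σ : Equiv.Perm (Fin N)) :
    MvPolynomial.rename σ (vdm N ^ 2) = vdm N ^ 2 := by
  have h : (MvPolynomial.rename σ).mapMatrix
      (Matrix.vandermonde fun a : Fin N => (MvPolynomial.X a : MvPolynomial (Fin N) ℂ)) =
      (Matrix.vandermonde fun a : Fin N =>
        (MvPolynomial.X a : MvPolynomial (Fin N) ℂ)).submatrix σ id := by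
    ext a b : 2
    simp [Matrix.vandermonde_apply]
  rw [vdm_sq, map_pow, AlgHom.map_det, h, Matrix.det_permute, mul_pow]
  rcases Int.units_eq_one_or (Equiv.Perm.sign σ) with h | h <;> simp [h]

theorem coeff_X_mul_const_eq {N c : ℕ} {P : MvPolynomial (Fin N) ℂ}
    (hP : ∀ σ : Equiv.Perm (Fin N), MvPolynomial.rename σ P = P) (a b : Fin N) :
    MvPolynomial.coeff (constExp N c) (MvPolynomial.X a * P) =
      MvPolynomial.coeff (constExp N c) (MvPolynomial.X b * P) := by
  have h := MvPolynomial.coeff_rename_mapDomain (Equiv.swap a b) (Equiv.injective _)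
    (MvPolynomial.X a * P) (constExp N c)
  rw [map_mul, MvPolynomial.rename_X, hP, Equiv.swap_apply_left] at h
  rw [← h]
  congr 1
  ext i
  rw [← Finsupp.equivMapDomain_eq_mapDomain, Finsupp.equivMapDomain_apply]
  rfl

theorem card_mul_phi (α N c : ℕ) (b : Fin N) (κ : Fin N →₀ ℕ)
    (hκ : κ + Finsupp.single b 1 = constExp N c) (f : V0) :
    (N : ℂ) * phi α κ f = phi α (constExp N c) (MvPolynomial.X 1 * f) := by
  have h1 : phi α κ f = MvPolynomial.coeff (constExp N c)
      (MvPolynomial.X b * (vdm N ^ (2 * α) * evalN N f)) := by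
    rw [← hκ, add_comm, MvPolynomial.coeff_X_mul, phi_apply]
  have h2 : ∀ σ : Equiv.Perm (Fin N), MvPolynomial.rename σ (vdm N ^ (2 * α) * evalN N f) =
      vdm N ^ (2 * α) * evalN N f := by
    intro σ
    rw [map_mul, rename_evalN, pow_mul, map_pow, rename_vdm_sq]
  rw [phi_apply α (constExp N c), map_mul, evalN_X, mul_left_comm, Finset.sum_mul, MvPolynomial.coeff_sum,
    Finset.sum_congr rfl (g := fun _ => phi α κ f), Finset.sum_const, Finset.card_univ,
    Fintype.card_fin, nsmul_eq_mul]
  intro a _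
  rw [h1, PNat.one_coe, pow_one]
  exact coeff_X_mul_const_eq h2 a b

/-- If a functional with Virasoro constraints of positive weight kills the ideal generated by `p_1`,
then it is zero. -/
theorem IsVirasoro.eq_zero_of_X_one {α N K : ℕ} {φ : V0 →ₗ[ℂ] ℂ} (hφ : IsVirasoro α N K φ)
    (hKN : K * N ≠ 0) (h1 : ∀ f, φ (MvPolynomial.X 1 * f) = 0) : φ = 0 := by
  have hq : ∃ c : ℂ, coeff 1 (quad α N K) = c • (MvPolynomial.X 1 : V0) := by
    have e0 : coeff 0 (psumFull N) = (N : V0) := by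
      rw [psumFull, map_add, psumSeries, coeff_zero_posSeries, add_zero,
        ← map_natCast (PowerSeries.C : V0 →+* PowerSeries V0), PowerSeries.coeff_C, if_pos rfl]
    have e1 : coeff 1 (psumFull N) = (MvPolynomial.X 1 : V0) := by
      rw [psumFull, map_add, ← map_natCast (PowerSeries.C : V0 →+* PowerSeries V0),
        PowerSeries.coeff_C, if_neg one_ne_zero, zero_add]
      exact coeff_posSeries _ 1
    refine ⟨α * (2 * N) + (1 - α) - (K + N * α), ?_⟩
    rw [quad, map_sub, map_add, PowerSeries.coeff_smul, PowerSeries.coeff_smul,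
      PowerSeries.coeff_smul, coeff_euler, pow_two, PowerSeries.coeff_mul,
      Finset.Nat.sum_antidiagonal_eq_sum_range_succ_mk, Finset.sum_range_succ,
      Finset.sum_range_one, tsub_zero, tsub_self, e0, e1]
    simp only [MvPolynomial.smul_eq_C_mul, map_sub, map_one, map_mul, map_add, map_natCast,
      map_ofNat]
    push_cast
    ring
  obtain ⟨c, hc⟩ := hq
  have hL : ∀ f, φ (virL 1 f) = 0 := by
    intro f
    have := hφ 1 f
    rwa [hc, map_add, smul_mul_assoc, map_smul, h1, smul_zero, zero_add] at this
  have hX : ∀ (k : ℕ+) f, φ (MvPolynomial.X k * f) = 0 := by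
    intro k
    induction k using PNat.recOn with
    | one => exact h1
    | succ k ih =>
      intro f
      have := hL (MvPolynomial.X k * f)
      rw [Derivation.leibniz, virL_X, smul_eq_mul, smul_eq_mul, map_add, ih, zero_add,
        mul_smul_comm, ← Nat.cast_smul_eq_nsmul ℂ, map_smul, smul_eq_mul] at this
      rw [mul_comm]
      exact (mul_eq_zero.1 this).resolve_left (by exact_mod_cast k.ne_zero)
  refine LinearMap.ext fun f => ?_
  induction f using V0.induction with
  | one =>
    have := hφ.virL_zero 1
    rw [Derivation.map_one_eq_zero, map_zero] at this
    exact (mul_eq_zero.1 this.symm).resolve_left (by exact_mod_cast hKN)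
  | add f g hf hg => rw [map_add, hf, hg]; simp
  | smul c f hf => rw [map_smul, hf]; simp
  | mul n f hf => exact hX n f

theorem phi_const_ne_zero (α N K : ℕ) : phi α (constExp (N + 1) (K + N * α)) ≠ 0 := by
  classical
  set e := constExp (N + 1) K
  obtain ⟨f, hf⟩ := toLam_surjective (mono (expType (embExp e)))
  have h1 : evalN (N + 1) f = MvPolynomial.monomial e 1 := by
    ext c
    rw [coeff_evalN, hf, coeff_mono, MvPolynomial.coeff_monomial]
    refine if_congr ⟨fun h => ?_, fun h => by rw [h]⟩ rfl rfl
    obtain ⟨s, hs⟩ := exists_perm h.symm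
    have hle : ∀ a, c a ≤ K := by
      intro a
      have h2 := embExp_apply c a
      rw [← h2, ← hs]
      obtain ⟨i, hi⟩ := s.surjective (a : ℕ)
      rw [← hi]
      refine (Finsupp.embDomain_apply_self s.toEmbedding (embExp e) i).trans_le ?_
      by_cases hr : i ∈ Set.range (Fin.valEmbedding : Fin (N + 1) ↪ ℕ)
      · obtain ⟨b, rfl⟩ := hr
        exact (Finsupp.embDomain_apply_self _ _ _).trans_le le_rfl
      · rw [embExp, Finsupp.embDomain_of_notMem_range _ _ _ hr]
        exact Nat.zero_le _
    have hdeg : ∀ x : Fin (N + 1) →₀ ℕ, wt (expType (embExp x)) = ∑ a, x a := by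
      intro x
      rw [wt_expType, embExp, Finsupp.degree_apply, Finsupp.support_embDomain, Finset.sum_map]
      simp only [Finsupp.embDomain_apply_self]
      exact Finset.sum_subset (Finset.subset_univ _) fun a _ ha => Finsupp.notMem_support_iff.1 ha
    have hsum : ∑ a, c a = ∑ a, e a := by rw [← hdeg, ← hdeg, h]
    ext a
    exact ((Finset.sum_eq_sum_iff_of_le fun a _ => hle a).1 hsum a (Finset.mem_univ a)).symm
  intro h0
  have h2 := LinearMap.congr_fun h0 f
  rw [phi_apply, h1, show constExp (N + 1) (K + N * α) = e + constExp (N + 1) (N * α) by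
    ext a; rfl, mul_comm (vdm (N + 1) ^ (2 * α)), MvPolynomial.coeff_monomial_mul, one_mul] at h2
  exact coeff_vdm_pow_ne_zero N α h2

/-! ### Recognizing Jack functions -/

theorem pair_monomial_right (α : ℕ) (f : V0) (l : Par) :
    pair α f (MvPolynomial.monomial l 1) =
      MvPolynomial.coeff l f * ((zee l : ℂ) * ((α : ℂ) ^ len l)⁻¹) := by
  classical
  induction f using MvPolynomial.induction_on' with
  | monomial m c =>
    rw [← mul_one c, ← smul_eq_mul, ← MvPolynomial.smul_monomial, map_smul, LinearMap.smul_apply,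
      pair_monomial, MvPolynomial.coeff_smul, MvPolynomial.coeff_monomial]
    by_cases h : m = l
    · subst h; simp
    · simp [h]
  | add f g hf hg => rw [map_add, LinearMap.add_apply, hf, hg, MvPolynomial.coeff_add, add_mul]

theorem zee_mul_ne_zero {α : ℕ} (hα : 0 < α) (l : Par) :
    (zee l : ℂ) * ((α : ℂ) ^ len l)⁻¹ ≠ 0 := by
  refine mul_ne_zero ?_ (inv_ne_zero (pow_ne_zero _ (by exact_mod_cast hα.ne')))
  have : zee l ≠ 0 := Finset.prod_ne_zero_iff.2 fun i _ =>
    mul_ne_zero (pow_ne_zero _ i.ne_zero) (Nat.factorial_ne_zero _)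
  exact_mod_cast this

theorem eq_zero_of_pair {α : ℕ} (hα : 0 < α) {f : V0} (h : ∀ g, pair α f g = 0) : f = 0 := by
  ext l
  have := h (MvPolynomial.monomial l 1)
  rw [pair_monomial_right] at this
  exact (mul_eq_zero.1 this).resolve_right (zee_mul_ne_zero hα l)

theorem virL_zero_monomial (l : Par) : virL 0 (MvPolynomial.monomial l 1) =
    (wt l : ℂ) • MvPolynomial.monomial l 1 := by
  rw [virL, MvPolynomial.mkDerivation_monomial, one_smul, wt, Finsupp.sum, Finsupp.sum,
    Nat.cast_sum, Finset.sum_smul]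
  refine Finset.sum_congr rfl fun i hi => ?_
  rw [addIdx_zero, smul_eq_mul, mul_smul_comm, MvPolynomial.X, MvPolynomial.monomial_mul, mul_one,
    tsub_add_cancel_of_le (Finsupp.single_le_iff.2
      (Nat.one_le_iff_ne_zero.2 (Finsupp.mem_support_iff.1 hi))), ← Nat.cast_smul_eq_nsmul ℂ,
    MvPolynomial.smul_monomial, MvPolynomial.smul_monomial]
  congr 1
  push_cast
  simp

/-- A functional supported in weight `w` is represented by a symmetric function of degree `w`. -/
theorem coeff_eq_zero_of_pair_virL {α : ℕ} (hα : 0 < α) {F : V0} {w : ℕ}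
    (h : ∀ f, pair α F (virL 0 f) = (w : ℂ) * pair α F f) (e : ℕ →₀ ℕ) (he : e.degree ≠ w) :
    MvPowerSeries.coeff e (toLam F : MvPowerSeries ℕ ℂ) = 0 := by
  rw [toLam_eq_sum, AddSubmonoidClass.coe_finsetSum, map_sum]
  refine Finset.sum_eq_zero fun l hl => ?_
  rw [Subalgebra.coe_smul, MvPowerSeries.coeff_smul]
  obtain ⟨k, h1, h2, -⟩ := coeff_psumPar l e
  rw [h1]
  by_cases hk : k = 0
  · rw [hk, Nat.cast_zero, mul_zero]
  exfalso
  have h3 := h (MvPolynomial.monomial l 1)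
  rw [virL_zero_monomial, map_smul, smul_eq_mul, ← sub_eq_zero, ← sub_mul, pair_monomial_right]
    at h3
  rcases mul_eq_zero.1 h3 with h4 | h4
  · apply he
    rw [(h2 hk).2.1]
    exact_mod_cast sub_eq_zero.1 h4
  · rcases mul_eq_zero.1 h4 with h5 | h5
    · exact MvPolynomial.mem_support_iff.1 hl h5
    · exact zee_mul_ne_zero hα l h5

/-- If the functional of `F` kills the ideal of `g_d`, then `F` has no monomial with exponent
`d`. -/
theorem coeff_eq_zero_of_pair_gen {α : ℕ} (hα : 0 < α) {F : V0} {d : ℕ}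
    (h : ∀ f, pair α F (coeff d (gen α) * f) = 0) (e : ℕ →₀ ℕ) {i : ℕ} (he : e i = d) :
    MvPowerSeries.coeff e (toLam F : MvPowerSeries ℕ ℂ) = 0 := by
  have h1 : coeff d (transl F) = 0 := eq_zero_of_pair hα fun g => by
    rw [pair_symm, ← pair_gen_mul hα, pair_symm, h]
  rw [coeff_toLam_erase F e i, he, h1, map_zero]
  rfl

/-- A nonzero symmetric function that is a combination of the `m_ν` with `ν ≤ μ` and orthogonal to
the `m_ν` with `ν < μ` is a multiple of the dual Jack function. -/
theorem exists_eq_smul_jackQ {α : ℕ} (hα : 0 < α) {F : Lam} {μ : Par} (hF : F ≠ 0)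
    (htri : ∀ e, MvPowerSeries.coeff e (F : MvPowerSeries ℕ ℂ) ≠ 0 → Dom (expType e) μ)
    (horth : ∀ ν, SDom ν μ → scal α F (mono ν) = 0) :
    ∃ c : ℂ, c ≠ 0 ∧ F = c • jackQ α μ := by
  classical
  set W := Submodule.span ℂ (mono '' {m | SDom m μ}) with hW
  obtain ⟨a, ha⟩ : ∃ a : ℂ, F - a • mono μ ∈ W := by
    have key := eq_sum_mono F (insert μ (finite_sdom μ).toFinset) (by
      intro e he
      by_contra h
      apply he
      rw [Finset.mem_insert, Set.Finite.mem_toFinset]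
      by_cases h' : expType e = μ
      · exact Or.inl h'
      · exact Or.inr ⟨htri e h, h'⟩)
    refine ⟨MvPowerSeries.coeff (exists_expType μ).choose (F : MvPowerSeries ℕ ℂ), ?_⟩
    rw [Finset.sum_insert (by simp [SDom])] at key
    rw [sub_eq_iff_eq_add'.2 key]
    exact sum_mem fun m hm => Submodule.smul_mem _ _
      (Submodule.subset_span ⟨m, (Set.Finite.mem_toFinset _).1 hm, rfl⟩)
  have hμ : mono μ ∉ W := by
    intro h
    obtain ⟨e, he⟩ := exists_expType μ
    have : ∀ x ∈ W, MvPowerSeries.coeff e (x : MvPowerSeries ℕ ℂ) = 0 := by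
      intro x hx
      induction hx using Submodule.span_induction with
      | mem x hx =>
        obtain ⟨m, hm, rfl⟩ := hx
        rw [coeff_mono, if_neg]
        rw [he]
        exact hm.2.symm
      | zero => exact map_zero _
      | add x y _ _ hx hy => rw [AddMemClass.coe_add, map_add, hx, hy, add_zero]
      | smul c x _ hx => rw [Subalgebra.coe_smul, MvPowerSeries.coeff_smul, hx, mul_zero]
    have h2 := this _ h
    rw [coeff_mono, if_pos he] at h2
    exact one_ne_zero h2
  have ha0 : a ≠ 0 := by
    rintro rfl
    rw [zero_smul, sub_zero] at ha
    exact hF (eq_zero_of_orthogonal hα {m | SDom m μ} ha horth)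
  have hJ := isJackP_jackP hα μ
  have hFJ : F = a • jackP α μ := by
    have h1 : IsJackP α μ (a⁻¹ • F) := by
      refine ⟨?_, fun m hm => ?_⟩
      · have := Submodule.smul_mem _ a⁻¹ ha
        rwa [smul_sub, smul_smul, inv_mul_cancel₀ ha0, one_smul] at this
      · rw [map_smul, LinearMap.smul_apply, horth m hm, smul_zero]
    rw [← IsJackP.unique hα h1 hJ, smul_smul, mul_inv_cancel₀ ha0, one_smul]
  have hn : scal α (jackP α μ) (jackP α μ) ≠ 0 := by
    intro h0
    have hmem : jackP α μ ∈ Submodule.span ℂ (mono '' (insert μ {m | SDom m μ})) := by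
      have h1 := add_mem (Submodule.span_mono (Set.image_mono (Set.subset_insert μ _)) hJ.1)
        (Submodule.subset_span (R := ℂ) ⟨μ, Set.mem_insert μ {m | SDom m μ}, rfl⟩)
      rwa [sub_add_cancel] at h1
    have hW0 : ∀ x ∈ W, scal α (jackP α μ) x = 0 := by
      intro x hx
      induction hx using Submodule.span_induction with
      | mem x hx => obtain ⟨m, hm, rfl⟩ := hx; exact hJ.2 m hm
      | zero => exact map_zero _
      | add x y _ _ hx hy => rw [map_add, hx, hy, add_zero]
      | smul c x _ hx => rw [map_smul, hx, smul_zero]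
    have h2 : scal α (jackP α μ) (mono μ) = 0 := by
      have := hW0 _ hJ.1
      rwa [map_sub, h0, zero_sub, neg_eq_zero] at this
    have h3 : jackP α μ = 0 := eq_zero_of_orthogonal hα _ hmem (by
      rintro m (rfl | hm)
      · exact h2
      · exact hJ.2 m hm)
    apply hμ
    have := hJ.1
    rw [h3, zero_sub] at this
    exact neg_mem_iff.1 this
  refine ⟨a * scal α (jackP α μ) (jackP α μ), mul_ne_zero ha0 hn, ?_⟩
  rw [jackQ, smul_smul, mul_assoc, mul_inv_cancel₀ hn, mul_one, hFJ]

/-! ### Balanced partitions -/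

theorem mem_rows {l : Par} {x : ℕ} : x ∈ rows l ↔ ∃ i : ℕ+, l i ≠ 0 ∧ (i : ℕ) = x := by
  simp [rows, Finsupp.mem_toMultiset]

theorem rows_pairwise (l : Par) : (rows l).Pairwise (· ≥ ·) :=
  Multiset.pairwise_sort _ _

theorem coe_rows (l : Par) :
    (rows l : Multiset ℕ) = (Finsupp.toMultiset l).map fun i : ℕ+ => (i : ℕ) :=
  Multiset.sort_eq _ _

theorem sum_rows (l : Par) : (rows l).sum = wt l := by
  rw [← Multiset.sum_coe, coe_rows]
  induction l using Finsupp.induction_linear with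
  | zero => simp [wt]
  | add f g hf hg => rw [map_add, Multiset.map_add, Multiset.sum_add, hf, hg, wt_add]
  | single i m =>
    rw [Finsupp.toMultiset_single, Multiset.map_nsmul, Multiset.sum_nsmul, wt,
      Finsupp.sum_single_index (mul_zero _)]
    simp [mul_comm]

theorem rows_sum_part {L : List ℕ} (hpos : ∀ x ∈ L, 0 < x) (hL : L.Pairwise (· ≥ ·)) :
    rows (L.map part).sum = L := by
  have h : ((Finsupp.toMultiset (L.map part).sum).map fun i : ℕ+ => (i : ℕ)) = (L : Multiset ℕ) := by
    clear hL
    induction L with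
    | nil => simp
    | cons a L ih =>
      rw [List.map_cons, List.sum_cons, map_add, Multiset.map_add, ih fun x hx => hpos x (by simp [hx]),
        part, dif_pos (hpos a (by simp)), Finsupp.toMultiset_single, one_smul,
        Multiset.map_singleton, ← Multiset.cons_coe, Multiset.singleton_add]
      rfl
  refine List.Perm.eq_of_pairwise (fun a b _ _ h1 h2 => le_antisymm h2 h1) (rows_pairwise _) hL ?_
  rw [← Multiset.coe_eq_coe, coe_rows, h]

theorem sum_take_le_mul {L : List ℕ} {K : ℕ} (h : ∀ x ∈ L, x ≤ K) (i : ℕ) :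
    (L.take i).sum ≤ i * K := by
  refine (List.sum_le_card_nsmul _ K fun x hx => h x (List.mem_of_mem_take hx)).trans ?_
  rw [smul_eq_mul]
  exact Nat.mul_le_mul_right K (List.length_take_le i L)

theorem sum_take_le_sum (L : List ℕ) (i : ℕ) : (L.take i).sum ≤ L.sum :=
  (List.take_sublist i L).sum_le_sum fun _ _ => Nat.zero_le _

theorem wt_smul_part_add (s K b : ℕ) : wt (s • part K + part b) = s * K + b := by
  induction s with
  | zero => simp [wt_part]
  | succ s ih => rw [succ_nsmul, add_right_comm, wt_add, ih, wt_part]; ring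

theorem le_sum_take_rows {s K b : ℕ} (hb : b ≤ K) (i : ℕ) :
    min (i * K) (s * K + b) ≤ ((rows (s • part K + part b)).take i).sum := by
  rcases Nat.eq_zero_or_pos K with rfl | hK
  · simp [Nat.le_zero.1 hb]
  set L : List ℕ := List.replicate s K ++ if b = 0 then [] else [b] with hL
  have h1 : rows (s • part K + part b) = L := by
    have h2 : s • part K + part b = (L.map part).sum := by
      rw [hL, List.map_append, List.sum_append, List.map_replicate, List.sum_replicate]
      split_ifs with h
      · subst h; simp [part]
      · simp
    rw [h2]
    refine rows_sum_part ?_ ?_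
    · intro x hx
      rw [hL, List.mem_append] at hx
      rcases hx with hx | hx
      · rw [List.eq_of_mem_replicate hx]; exact hK
      · split_ifs at hx with h
        · simp at hx
        · rw [List.mem_singleton.1 hx]; omega
    · rw [hL, List.pairwise_append]
      refine ⟨List.pairwise_replicate.2 (Or.inr le_rfl), by split_ifs <;> simp, ?_⟩
      intro x hx y hy
      rw [List.eq_of_mem_replicate hx]
      split_ifs at hy with h
      · simp at hy
      · rw [List.mem_singleton.1 hy]; exact hb
  rw [h1, hL]
  rcases le_or_gt i s with hi | hi
  · rw [List.take_append_of_le_length (by simpa using hi), List.take_replicate, List.sum_replicate,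
      min_eq_left hi, smul_eq_mul]
    exact min_le_left _ _
  · rw [List.take_of_length_le]
    · refine (min_le_right _ _).trans ?_
      rw [List.sum_append, List.sum_replicate, smul_eq_mul]
      split_ifs with h
      · simp [h]
      · simp
    · split_ifs <;> simp <;> omega

/-- Among the partitions of a given weight with parts at most `K`, the partition `(K^s, b)` is the
largest. -/
theorem dom_of_parts_le {s K b : ℕ} (hb : b ≤ K) {ν : Par} (hw : wt ν = s * K + b)
    (h : ∀ i : ℕ+, ν i ≠ 0 → (i : ℕ) ≤ K) : Dom ν (s • part K + part b) := by
  refine ⟨by rw [hw, wt_smul_part_add], fun i => ?_⟩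
  refine le_trans (le_min ?_ ?_) (le_sum_take_rows hb i)
  · refine sum_take_le_mul (fun x hx => ?_) i
    obtain ⟨j, hj, rfl⟩ := mem_rows.1 hx
    exact h j hj
  · rw [← hw, ← sum_rows]
    exact sum_take_le_sum _ _

theorem parts_le_of_dom {ν μ : Par} {K : ℕ} (hd : Dom ν μ)
    (hμ : ∀ i : ℕ+, μ i ≠ 0 → (i : ℕ) ≤ K) (i : ℕ+) (hi : ν i ≠ 0) : (i : ℕ) ≤ K := by
  have h1 : (i : ℕ) ≤ ((rows ν).take 1).sum := by
    have hm : (i : ℕ) ∈ rows ν := mem_rows.2 ⟨i, hi, rfl⟩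
    have hp := rows_pairwise ν
    generalize rows ν = L at hm hp
    cases L with
    | nil => simp at hm
    | cons x L =>
      rw [List.take_succ_cons, List.take_zero, List.sum_singleton]
      rcases List.mem_cons.1 hm with h | h
      · exact h.le
      · exact (List.pairwise_cons.1 hp).1 _ h
  refine (h1.trans (hd.2 1)).trans ((sum_take_le_mul (fun x hx => ?_) 1).trans_eq (one_mul K))
  obtain ⟨j, hj, rfl⟩ := mem_rows.1 hx
  exact hμ j hj

theorem parts_smul_part_add_le {s K b : ℕ} (hb : b ≤ K) (i : ℕ+)
    (hi : (s • part K + part b : Par) i ≠ 0) : (i : ℕ) ≤ K := by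
  have hpart : ∀ a : ℕ, part a i ≠ 0 → (i : ℕ) = a := by
    intro a ha
    unfold part at ha
    split_ifs at ha with h
    · rw [Finsupp.single_apply] at ha
      by_contra h'
      rw [if_neg] at ha
      · exact ha rfl
      · rintro rfl
        exact h' rfl
    · simp at ha
  rw [Finsupp.add_apply, Finsupp.smul_apply] at hi
  by_cases h : part b i = 0
  · rw [h, add_zero, smul_eq_mul] at hi
    exact (hpart K (right_ne_zero_of_mul hi)).le
  · exact (hpart b h).trans_le hb

theorem expType_embExp {N : ℕ} (c : Fin N →₀ ℕ) : expType (embExp c) = ∑ a, part (c a) := by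
  rw [expType, embExp, Finsupp.sum, Finsupp.support_embDomain, Finset.sum_map]
  simp only [Finsupp.embDomain_apply_self]
  refine Finset.sum_subset (Finset.subset_univ _) fun a _ ha => ?_
  rw [Finsupp.notMem_support_iff.1 ha, part, dif_neg (lt_irrefl 0)]

theorem wt_expType_embExp {N : ℕ} (c : Fin N →₀ ℕ) : wt (expType (embExp c)) = ∑ a, c a := by
  rw [expType_embExp]
  have : ∀ s : Finset (Fin N), wt (∑ a ∈ s, part (c a)) = ∑ a ∈ s, c a := by
    intro s
    induction s using Finset.induction_on with
    | empty => simp [wt]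
    | insert a s ha ih => rw [Finset.sum_insert ha, Finset.sum_insert ha, wt_add, wt_part, ih]
  exact this _

theorem expType_ne_zero {e : ℕ →₀ ℕ} {i : ℕ+} : expType e i ≠ 0 ↔ ∃ j, e j = i := by
  rw [expType_apply, Finset.card_ne_zero]
  constructor
  · rintro ⟨j, hj⟩
    exact ⟨j, (Finset.mem_filter.1 hj).2⟩
  · rintro ⟨j, hj⟩
    refine ⟨j, Finset.mem_filter.2 ⟨Finsupp.mem_support_iff.2 ?_, hj⟩⟩
    rw [hj]
    exact i.ne_zero

/-- Recognition of dual Jack functions of balanced shape from their linear functionals. -/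
theorem exists_toLam_eq_smul_jackQ {α : ℕ} (hα : 0 < α) {N s K b w : ℕ} (hb : b ≤ K)
    (hw : w = s * K + b) {F : V0} {κ : Fin N →₀ ℕ} (hF : ∀ f, pair α F f = phi α κ f)
    (hne : ∃ f, pair α F f ≠ 0)
    (hgen : ∀ d f, K < d → pair α F (coeff d (gen α) * f) = 0)
    (hvir : ∀ f, pair α F (virL 0 f) = (w : ℂ) * pair α F f)
    (huniq : ∀ c : Fin N →₀ ℕ, (∀ a, c a ≤ K) → ∑ a, c a = w →
      expType (embExp c) = s • part K + part b) :
    ∃ c : ℂ, c ≠ 0 ∧ toLam F = c • jackQ α (s • part K + part b) := by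
  refine exists_eq_smul_jackQ hα ?_ ?_ ?_
  · intro h
    obtain ⟨f, hf⟩ := hne
    apply hf
    rw [pair_apply, h, map_zero, LinearMap.zero_apply]
  · intro e he
    have hdeg : e.degree = w := by
      by_contra h
      exact he (coeff_eq_zero_of_pair_virL hα hvir e h)
    refine dom_of_parts_le hb (by rw [wt_expType, hdeg, hw]) fun i hi => ?_
    obtain ⟨j, hj⟩ := expType_ne_zero.1 hi
    by_contra h
    exact he (coeff_eq_zero_of_pair_gen hα (fun f => hgen i f (not_le.1 h)) e hj)
  · intro ν hν
    obtain ⟨f, hf⟩ := toLam_surjective (mono ν)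
    have h0 : evalN N f = 0 := by
      ext c
      rw [coeff_evalN, hf, coeff_mono, MvPolynomial.coeff_zero, if_neg]
      intro hc
      refine hν.2 (hc.symm.trans (huniq c (fun a => ?_) ?_))
      · rcases Nat.eq_zero_or_pos (c a) with h | h
        · rw [h]; exact Nat.zero_le _
        · refine parts_le_of_dom hν.1 (parts_smul_part_add_le hb) ⟨c a, h⟩ ?_
          rw [← hc]
          exact expType_ne_zero.2 ⟨a, embExp_apply c a⟩
      · rw [← wt_expType_embExp, hc, hν.1.1, wt_smul_part_add, hw]
    rw [← hf, ← pair_apply, hF, phi_apply, h0, mul_zero, MvPolynomial.coeff_zero]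

theorem eq_const_of_sum {N K : ℕ} {c : Fin N →₀ ℕ} (hc : ∀ a, c a ≤ K)
    (hs : ∑ a, c a = N * K) : expType (embExp c) = N • part K + part 0 := by
  have h : ∑ a, c a = ∑ _a : Fin N, K := by simpa using hs
  have h2 := (Finset.sum_eq_sum_iff_of_le fun a _ => hc a).1 h
  rw [expType_embExp, Finset.sum_congr rfl fun a ha => by rw [h2 a ha], Finset.sum_const,
    Finset.card_univ, Fintype.card_fin]
  simp [part]

theorem eq_of_sum_succ {N K : ℕ} {c : Fin (N + 1) →₀ ℕ} (hc : ∀ a, c a ≤ K + 1)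
    (hs : ∑ a, c a = N * (K + 1) + K) :
    expType (embExp c) = N • part (K + 1) + part K := by
  obtain ⟨a, ha⟩ : ∃ a, c a ≤ K := by
    by_contra! h
    have h1 : ∑ a, c a = ∑ _a : Fin (N + 1), (K + 1) :=
      Finset.sum_congr rfl fun a _ => le_antisymm (hc a) (h a)
    rw [hs, Finset.sum_const, Finset.card_univ, Fintype.card_fin, smul_eq_mul] at h1
    have : (N + 1) * (K + 1) = N * (K + 1) + (K + 1) := by ring
    omega
  have hcard : ((Finset.univ : Finset (Fin (N + 1))).erase a).card = N := by
    rw [Finset.card_erase_of_mem (Finset.mem_univ a), Finset.card_univ, Fintype.card_fin,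
      add_tsub_cancel_right]
  have hle : ∑ b ∈ Finset.univ.erase a, c b ≤ ∑ _b ∈ Finset.univ.erase a, (K + 1) :=
    Finset.sum_le_sum fun b _ => hc b
  have hsum := Finset.add_sum_erase Finset.univ c (Finset.mem_univ a)
  have hconst : ∑ _b ∈ (Finset.univ : Finset (Fin (N + 1))).erase a, (K + 1) = N * (K + 1) := by
    rw [Finset.sum_const, hcard, smul_eq_mul]
  have h2 := (Finset.sum_eq_sum_iff_of_le (s := Finset.univ.erase a) fun b _ => hc b).1 (by omega)
  rw [expType_embExp, ← Finset.add_sum_erase _ _ (Finset.mem_univ a),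
    Finset.sum_congr rfl fun b hb => by rw [h2 b hb], Finset.sum_const, hcard,
    show c a = K by omega, add_comm]

theorem T_single (j : ℤ) (f : V0) : T (Finsupp.single j f) = toLam f := by
  simp [T]

theorem ofParts_shape (k s t K b : ℕ) (r : ℤ) (α : ℕ) (hK : (K : ℤ) = k + 1 - r * α)
    (hb : t = 0 ∧ b = 0 ∨ t = 1 ∧ (b : ℤ) = k - r * α) :
    ofParts ((shape k s t).map fun a => a - r * (α : ℤ)) = s • part K + part b := by
  rw [shape, List.map_append, List.map_replicate, List.map_replicate, ofParts, List.map_append,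
    List.map_replicate, List.map_replicate, List.sum_append, List.sum_replicate,
    List.sum_replicate, ← hK, Int.toNat_natCast]
  congr 1
  rcases hb with ⟨rfl, rfl⟩ | ⟨rfl, hb⟩
  · simp [part]
  · rw [one_smul, ← hb, Int.toNat_natCast]

/-- The case of rectangular shapes. -/
theorem rectangular (k N α : ℕ) (r : ℤ) (hα : 0 < α) (hr : r * (α : ℤ) ≤ (k : ℤ) + 1) :
    ∃ c : ℂ, c ≠ 0 ∧ T (XProd α (shape k (N + 1) 0) (expVec (-(((N + 1 : ℕ) : ℤ) + (0 : ℕ) - r)))) =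
      c • jackQ α (ofParts ((shape k (N + 1) 0).map fun a => a - r * (α : ℤ))) := by
  obtain ⟨K, hK⟩ := Int.eq_ofNat_of_zero_le (show 0 ≤ (k : ℤ) + 1 - r * α by omega)
  rw [ofParts_shape k (N + 1) 0 K 0 r α hK.symm (Or.inl ⟨rfl, rfl⟩)]
  obtain ⟨F, hX, hF⟩ := exists_XProd_eq hα (-(((N + 1 : ℕ) : ℤ) + (0 : ℕ) - r)) (N + 1)
    (constExp (N + 1) (K + N * α))
  have hlist : (List.ofFn fun a : Fin (N + 1) => ((constExp (N + 1) (K + N * α) a : ℕ) : ℤ) +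
      (-(((N + 1 : ℕ) : ℤ) + (0 : ℕ) - r) + 1) * α) = shape k (N + 1) 0 := by
    simp only [constExp_apply]
    rw [List.ofFn_const, shape, List.replicate_zero, List.append_nil]
    congr 1
    push_cast
    linear_combination -hK
  rw [hlist] at hX
  rw [hX, T_single]
  have hv : IsVirasoro α (N + 1) K (pair α F) := by
    have : pair α F = phi α (constExp (N + 1) (K + N * α)) := LinearMap.ext hF
    rw [this]
    exact isVirasoro_phi α N K
  refine exists_toLam_eq_smul_jackQ hα (Nat.zero_le _) rfl hF ?_
    (fun d f hd => hv.gen_mul_eq_zero hα hd f) (fun f => ?_) fun c hc hs => eq_const_of_sum hc hs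
  · by_contra! h
    exact phi_const_ne_zero α N K (LinearMap.ext fun f => (hF f).symm.trans (h f))
  · rw [hv.virL_zero]
    push_cast
    ring

/-- The case of marked rectangular shapes. -/
theorem marked_rectangular (k s α : ℕ) (r : ℤ) (hα : 0 < α)
    (hr : r * (α : ℤ) ≤ (k : ℤ)) :
    ∃ c : ℂ, c ≠ 0 ∧ T (XProd α (shape k s 1) (expVec (-((s : ℤ) + (1 : ℕ) - r)))) =
      c • jackQ α (ofParts ((shape k s 1).map fun a => a - r * (α : ℤ))) := by
  obtain ⟨K, hK⟩ := Int.eq_ofNat_of_zero_le (show 0 ≤ (k : ℤ) - r * α by omega)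
  rw [ofParts_shape k s 1 (K + 1) K r α (by push_cast; linear_combination -hK)
    (Or.inr ⟨rfl, hK.symm⟩)]
  set κ : Fin (s + 1) →₀ ℕ := constExp (s + 1) (K + 1 + s * α) - Finsupp.single (Fin.last s) 1
    with hκ
  have hκ' : κ + Finsupp.single (Fin.last s) 1 = constExp (s + 1) (K + 1 + s * α) :=
    tsub_add_cancel_of_le (Finsupp.single_le_iff.2 (by rw [constExp_apply]; omega))
  obtain ⟨F, hX, hF⟩ := exists_XProd_eq hα (-((s : ℤ) + (1 : ℕ) - r)) (s + 1) κ
  have hlist : (List.ofFn fun a : Fin (s + 1) => ((κ a : ℕ) : ℤ) +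
      (-((s : ℤ) + (1 : ℕ) - r) + 1) * α) = shape k s 1 := by
    have h1 : ∀ a : Fin s, κ a.castSucc = K + 1 + s * α := by
      intro a
      rw [hκ, Finsupp.coe_tsub, Pi.sub_apply, Finsupp.single_eq_of_ne (Fin.castSucc_lt_last a).ne,
        constExp_apply, tsub_zero]
    have h2 : κ (Fin.last s) = K + s * α := by
      rw [hκ, Finsupp.coe_tsub, Pi.sub_apply, Finsupp.single_eq_same, constExp_apply]
      omega
    rw [List.ofFn_succ', shape, List.replicate_one]
    simp only [h1, h2, List.ofFn_const, List.concat_eq_append]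
    congr 2
    · push_cast
      linear_combination -hK
    · push_cast
      linear_combination -hK
  rw [hlist] at hX
  rw [hX, T_single]
  set φ := phi α (constExp (s + 1) (K + 1 + s * α))
  have hv : IsVirasoro α (s + 1) (K + 1) φ := isVirasoro_phi α s (K + 1)
  have hN : ((s + 1 : ℕ) : ℂ) ≠ 0 := by exact_mod_cast s.succ_ne_zero
  have hFφ : ∀ f, ((s + 1 : ℕ) : ℂ) * pair α F f = φ (MvPolynomial.X 1 * f) := fun f => by
    rw [hF, ← phi_apply]
    exact card_mul_phi α (s + 1) (K + 1 + s * α) (Fin.last s) κ hκ' f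
  refine exists_toLam_eq_smul_jackQ hα (Nat.le_succ K) rfl hF ?_ (fun d f hd => ?_) (fun f => ?_)
    fun c hc hs => eq_of_sum_succ hc hs
  · by_contra! h
    refine phi_const_ne_zero α s (K + 1) (hv.eq_zero_of_X_one (by positivity) fun f => ?_)
    rw [← hFφ, h, mul_zero]
  · refine (mul_eq_zero.1 ((hFφ _).trans ?_)).resolve_left hN
    rw [mul_left_comm]
    exact hv.gen_mul_eq_zero hα hd _
  · refine mul_left_cancel₀ hN ?_
    rw [mul_left_comm, hFφ, hFφ]
    have h1 : MvPolynomial.X 1 * virL 0 f = virL 0 (MvPolynomial.X 1 * f) - MvPolynomial.X 1 * f := by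
      rw [Derivation.leibniz, virL_X, addIdx_zero, smul_eq_mul, smul_eq_mul, PNat.one_coe, one_smul]
      ring
    rw [h1, map_sub, hv.virL_zero]
    push_cast
    ring

end VertexJack

end

theorem mainTheorem2 (k s t α : ℕ) (r : ℤ) (hs : 0 < s) (ht : t = 0 ∨ t = 1) (hα : 0 < α)
    (hr : r * (α : ℤ) ≤ (k : ℤ) + if t = 0 then 1 else 0) :
    ∃ c : ℂ, c ≠ 0 ∧
      VertexJack.T (VertexJack.XProd α (VertexJack.shape k s t)
          (VertexJack.expVec (-((s : ℤ) + (t : ℤ) - r)))) =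
        c • VertexJack.jackQ α
          (VertexJack.ofParts ((VertexJack.shape k s t).map fun a => a - r * (α : ℤ))) := by
  rcases ht with rfl | rfl
  · obtain ⟨N, rfl⟩ := Nat.exists_eq_succ_of_ne_zero hs.ne'
    exact VertexJack.rectangular k N α r hα (by simpa using hr)
  · exact VertexJack.marked_rectangular k s α r hα (by simpa using hr)
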